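/- Let $a,d\in\mathbb N$ and let $\mathbf X_{ik}=(X_{i1k},\dots,X_{idk})'$, $i=1,\dots,a$, $k=1,2,\dots$, be independent $\mathbb R^d$-valued random vectors on a probability space $(\Omega,\mathcal A,P)$, where for each $i$ all $\mathbf X_{ik}$ have the same, otherwise arbitrary, distribution $Q_i$. Let $F_{ij}(x)=\tfrac12\{P(X_{ij1}<x)+P(X_{ij1}\le x)\}$ be the normalized distribution functions. From group $i$ the vectors $\mathbf X_{i1},\dots,\mathbf X_{in_i}$ are observed; $N=\sum_{i=1}^a n_i$ and $\mathbf X$ denotes all observed data. Assume that $n_i/N\to\lambda_i\in(0,1)$ for all $i$ as $N\to\infty$. With $c(u)=\mathbf 1\{u>0\}+\tfrac12\mathbf 1\{u=0\}$ let $$\widehat F_{ij}(x)=\frac1{n_i}\sum_{k=1}^{n_i}c(x-X_{ijk}),\qquad \widehat G_j=\frac1a\sum_{\ell=1}^a\widehat F_{\ell j},\qquad \widehat p_{ij}=\int\widehat G_j\,d\widehat F_{ij}=\frac1{n_i}\sum_{k=1}^{n_i}\widehat G_j(X_{ijk}),$$ and $\widehat{\mathbf p}=(\widehat p_{11},\widehat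 p_{12},\dots,\widehat p_{ad})'$. Given $\mathbf X$, draw, independently for the different groups, for each $i$ independently and with replacement $n_i$ vectors $\mathbf X^*_{i1},\dots,\mathbf X^*_{in_i}$ uniformly from $\mathbf X_{i1},\dots,\mathbf X_{in_i}$, and let $\mathbf p^*$ be computed from the $\mathbf X^*_{ik}$ in the same way as $\widehat{\mathbf p}$ from the $\mathbf X_{ik}$. For groups $g,i,i'$ and components $j,j'$ put $\kappa_g(ij,i'j')=\operatorname{cov}\big(F_{ij}(X_{gj1}),F_{i'j'}(X_{gj'1})\big)$, and let $\boldsymbol\Sigma\in\mathbb R^{ad\times ad}$ be the matrix with the entries $$\boldsymbol\Sigma_{(i,j),(i',j')}=\frac1{a^2}\sum_{\ell=1}^a\sum_{\ell'=1}^a\sigma_{\ell ij,\ell'i'j'},$$ $$\sigma_{\ell ij,\ell'i'j'}=\frac{\delta_{\ell\ell'}}{\lambda_\ell}\kappa_\ell(ij,i'j')-\frac{\delta_{\ell i'}}{\lambda_\ell}\kappa_\ell(ij,\ell'j')+\frac{\delta_{ii'}}{\lambda_i}\kappa_i(\ell j,\ell'j')-\frac{\delta_{i\ell'}}{\lambda_i}\kappa_i(\ell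 j,i'j').$$ Then $\boldsymbol\Sigma$ is symmetric and positive semidefinite and, as $N\to\infty$, conditionally on $\mathbf X$, $$\sqrt N(\mathbf p^*-\widehat{\mathbf p})\stackrel{d}{\longrightarrow}N_{ad}(\mathbf 0,\boldsymbol\Sigma)\quad\text{in outer probability},$$ that is, the bounded Lipschitz distance $\sup_h\big|E[h(\sqrt N(\mathbf p^*-\widehat{\mathbf p}))\mid\mathbf X]-\int h\,dN_{ad}(\mathbf 0,\boldsymbol\Sigma)\big|$, with the supremum over all $1$-Lipschitz $h:\mathbb R^{ad}\to[-1,1]$, converges to $0$ in outer $P$-probability. No restriction is put on the effects $p_{ij}=\frac1a\sum_{\ell=1}^a\int F_{\ell j}\,dF_{ij}$, so the convergence holds under every null hypothesis $\mathbf T\mathbf p=\mathbf 0$ as well as under every alternative $\mathbf T\mathbf p\ne\mathbf 0$. -/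

import Mathlib

open MeasureTheory ProbabilityTheory Filter Topology
open scoped ENNReal

noncomputable section

namespace MannWhitneyManova

/-! ### Empirical and bootstrapped effects

A sample is a family `x i k j`: component `j` of individual `k` in group `i`, where group `i`
consists of `n i` individuals. -/

/-- The counting function `c(u) = 1{u > 0} + (1/2) 1{u = 0}`. -/
def countFun (u : ℝ) : ℝ :=
  (if 0 < u then 1 else 0) + (if u = 0 then 1 / 2 else 0)

/-- The normalized empirical distribution function of component `j` in group `i`,
`t ↦ (1 / n i) ∑ₖ c (t - x i k j)`. -/
def empCDF {a d : ℕ} {n : Fin a → ℕ} (x : (i : Fin a) → Fin (n i) → Fin d → ℝ)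
    (i : Fin a) (j : Fin d) (t : ℝ) : ℝ :=
  (1 / (n i : ℝ)) * ∑ k : Fin (n i), countFun (t - x i k j)

/-- The unweighted mean over all groups of the normalized empirical distribution functions of
component `j`. -/
def meanEmpCDF {a d : ℕ} {n : Fin a → ℕ} (x : (i : Fin a) → Fin (n i) → Fin d → ℝ)
    (j : Fin d) (t : ℝ) : ℝ :=
  (1 / (a : ℝ)) * ∑ l : Fin a, empCDF x l j t

/-- The effect of group `i` in component `j` computed from the sample: the integral of the mean
empirical distribution function against the empirical distribution of component `j` in
group `i`. -/
def empEffect {a d : ℕ} {n : Fin a → ℕ} (x : (i : Fin a) → Fin (n i) → Fin d → ℝ)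
    (i : Fin a) (j : Fin d) : ℝ :=
  (1 / (n i : ℝ)) * ∑ k : Fin (n i), meanEmpCDF x j (x i k j)

/-- The group-wise resampled data: the individual `k` of group `i` is replaced by the whole
`d`-vector of the individual `K ⟨i, k⟩` of the same group. -/
def resample {a d : ℕ} {n : Fin a → ℕ} (x : (i : Fin a) → Fin (n i) → Fin d → ℝ)
    (K : (s : (i : Fin a) × Fin (n i)) → Fin (n s.1)) :
    (i : Fin a) → Fin (n i) → Fin d → ℝ :=
  fun i k => x i (K ⟨i, k⟩)

/-- The law of the resampling indices: they are independent, and each index belonging to group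
`i` is uniformly distributed on the `n i` individuals of that group. -/
def indexLaw {a : ℕ} (n : Fin a → ℕ) :
    Measure ((s : (i : Fin a) × Fin (n i)) → Fin (n s.1)) :=
  Measure.pi fun s => uniformOn (Set.univ : Set (Fin (n s.1)))

/-- The conditional law, given that the data equal `x`, of `√N (p* - p̂)`, where `N` is the total
sample size, `p̂` the vector of effects of the data and `p*` that of the resampled data. -/
def bootLaw {a d : ℕ} {n : Fin a → ℕ} (x : (i : Fin a) → Fin (n i) → Fin d → ℝ) :
    Measure (EuclideanSpace ℝ (Fin a × Fin d)) :=
  (indexLaw n).map fun K => WithLp.toLp 2 fun s : Fin a × Fin d =>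
    Real.sqrt ((∑ i, n i : ℕ) : ℝ) *
      (empEffect (resample x K) s.1 s.2 - empEffect x s.1 s.2)

/-! ### The limit covariance matrix

`Q i` is the distribution on `ℝ^d` of the observations in group `i`. -/

/-- The normalized distribution function of component `j` in group `i`: the mean of the left- and
the right-continuous version. -/
def normCDF {a d : ℕ} (Q : Fin a → Measure (Fin d → ℝ)) (i : Fin a) (j : Fin d) (t : ℝ) : ℝ :=
  ((Q i).real {y | y j < t} + (Q i).real {y | y j ≤ t}) / 2

/-- `groupCov Q g i j i' j'` is the covariance of `F_{ij}(X_{gj1})` and `F_{i'j'}(X_{gj'1})`,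
where `X_{g·1}` has the distribution `Q g`. -/
def groupCov {a d : ℕ} (Q : Fin a → Measure (Fin d → ℝ)) (g i : Fin a) (j : Fin d)
    (i' : Fin a) (j' : Fin d) : ℝ :=
  cov[fun y : Fin d → ℝ => normCDF Q i j (y j), fun y : Fin d → ℝ => normCDF Q i' j' (y j'); Q g]

/-- The asymptotic covariance `σ_{ℓij,ℓ'i'j'}` of the estimated pairwise Mann-Whitney effects
`√N ŵ_{ℓij}` and `√N ŵ_{ℓ'i'j'}`, where `lam i` is the limit proportion of group `i`. -/
def pairCov {a d : ℕ} (Q : Fin a → Measure (Fin d → ℝ)) (lam : Fin a → ℝ)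
    (l i : Fin a) (j : Fin d) (l' i' : Fin a) (j' : Fin d) : ℝ :=
  (if l = l' then (1 / lam l) * groupCov Q l i j i' j' else 0)
    - (if l = i' then (1 / lam l) * groupCov Q l i j l' j' else 0)
    + (if i = i' then (1 / lam i) * groupCov Q i l j l' j' else 0)
    - (if i = l' then (1 / lam i) * groupCov Q i l j i' j' else 0)

/-- The limit covariance matrix of `√N (p̂ - p)`. -/
def limitCov {a d : ℕ} (Q : Fin a → Measure (Fin d → ℝ)) (lam : Fin a → ℝ) :
    Matrix (Fin a × Fin d) (Fin a × Fin d) ℝ :=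
  Matrix.of fun s s' =>
    (1 / (a : ℝ) ^ 2) * ∑ l : Fin a, ∑ l' : Fin a, pairCov Q lam l s.1 s.2 l' s'.1 s'.2

/-! ### Conditional convergence in distribution, in outer probability -/

/-- The bounded Lipschitz distance `sup |∫ h dμ - ∫ h dν|` over all `1`-Lipschitz functions
`h : E → [-1, 1]`. -/
def blDist {E : Type*} [PseudoEMetricSpace E] [MeasurableSpace E] (μ ν : Measure E) : ℝ≥0∞ :=
  ⨆ h : {h : E → ℝ // LipschitzWith 1 h ∧ ∀ x, |h x| ≤ 1},
    ENNReal.ofReal |∫ x, h.1 x ∂μ - ∫ x, h.1 x ∂ν|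

/-- The (conditional) laws `L m ω` converge weakly to `ν` in outer `P`-probability: their bounded
Lipschitz distance to `ν` tends to `0` in outer probability. The value of a measure at a set that
need not be measurable is its outer measure. -/
def CondTendstoInOuterProb {Ω E : Type*} [MeasurableSpace Ω] [PseudoEMetricSpace E]
    [MeasurableSpace E] (P : Measure Ω) (L : ℕ → Ω → Measure E) (ν : Measure E) : Prop :=
  ∀ ε : ℝ≥0∞, 0 < ε → Tendsto (fun m => P {ω | ε ≤ blDist (L m ω) ν}) atTop (𝓝 0)

end MannWhitneyManova

end

/-! The data are fixed outside one null set, and the conditional laws are shown to converge along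
that realization. The effects are averages of pairwise effects, which are two-sample U-statistics.
Under the resampling law, each deviation of a resampled pairwise effect from the empirical one
splits, in the manner of Hoeffding, into a degenerate double sum and two centred group means of
empirical distribution functions (`pairEffect_resample_sub`). The degenerate part is a sum of
orthogonal bounded terms, so its `L¹` norm is of order `1/√(n_l n_i)`, negligible against `1/√N`. By
Glivenko-Cantelli (`glivenko_cantelli`) the empirical distribution functions in the group means may
be replaced by the true ones at a cost of order `ε/√n`.

What remains is `linStat`, a sum over groups of bootstrap means of the fixed bounded functions
`projFun`. Its characteristic function factors over the groups into powers of averages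
(`charFun_linStat`), and `tendsto_mean_exp_pow` together with the law of large numbers gives a
Gaussian limit with quadratic form `∑ g, Var / lam g`. This is the form of `limitCov`
(`dotProduct_limitCov_mulVec`), which also shows that the matrix is positive semidefinite.

Weak convergence is turned into bounded Lipschitz convergence through the Lévy-Prokhorov metric, and
almost sure convergence into convergence in probability through measurability of the distance. The
bootstrap is centred at the empirical effects and Glivenko-Cantelli needs no continuity, so neither
the true effects nor ties matter. -/

namespace MannWhitneyManova

/-! ### Moments under the resampling law -/

section IndexLaw

variable {a : ℕ} {n : Fin a → ℕ} [∀ i, NeZero (n i)]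

instance isProbabilityMeasure_indexLaw : IsProbabilityMeasure (indexLaw n) := by
  unfold indexLaw
  have (s : (i : Fin a) × Fin (n i)) :
      IsProbabilityMeasure (uniformOn (Set.univ : Set (Fin (n s.1)))) :=
    isProbabilityMeasure_uniformOn Set.finite_univ Set.univ_nonempty
  infer_instance

lemma integrable_indexLaw {E : Type*} [NormedAddCommGroup E]
    (f : ((s : (i : Fin a) × Fin (n i)) → Fin (n s.1)) → E) : Integrable f (indexLaw n) :=
  .of_finite

lemma uniformOn_univ_real_singleton {k : ℕ} (u : Fin k) :
    (uniformOn (Set.univ : Set (Fin k))).real {u} = (k : ℝ)⁻¹ := by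
  rw [measureReal_def, uniformOn_univ]
  simp

lemma integral_uniformOn_univ {E : Type*} [NormedAddCommGroup E] [NormedSpace ℝ E]
    [CompleteSpace E] {k : ℕ}
    [NeZero k] (f : Fin k → E) :
    ∫ u, f u ∂(uniformOn (Set.univ : Set (Fin k))) = (k : ℝ)⁻¹ • ∑ u, f u := by
  have : IsProbabilityMeasure (uniformOn (Set.univ : Set (Fin k))) :=
    isProbabilityMeasure_uniformOn Set.finite_univ Set.univ_nonempty
  rw [integral_fintype .of_finite]
  simp_rw [uniformOn_univ_real_singleton, Finset.smul_sum]

lemma indexLaw_real_singleton (K : (s : (i : Fin a) × Fin (n i)) → Fin (n s.1)) :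
    (indexLaw n).real {K} = ∏ s : (i : Fin a) × Fin (n i), (n s.1 : ℝ)⁻¹ := by
  have (s : (i : Fin a) × Fin (n i)) :
      IsProbabilityMeasure (uniformOn (Set.univ : Set (Fin (n s.1)))) :=
    isProbabilityMeasure_uniformOn Set.finite_univ Set.univ_nonempty
  rw [measureReal_def, indexLaw, Measure.pi_singleton, ENNReal.toReal_prod]
  exact Finset.prod_congr rfl fun s _ => uniformOn_univ_real_singleton (K s)

lemma integral_indexLaw (f : ((s : (i : Fin a) × Fin (n i)) → Fin (n s.1)) → ℝ) :
    ∫ K, f K ∂(indexLaw n) =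
      (∏ s : (i : Fin a) × Fin (n i), (n s.1 : ℝ)⁻¹) * ∑ K, f K := by
  rw [integral_fintype .of_finite, Finset.mul_sum]
  simp_rw [indexLaw_real_singleton, smul_eq_mul]

/-- Integrating out one coordinate: if the average over one resampling index vanishes, so does
the expectation. -/
lemma integral_indexLaw_eq_zero (f : ((s : (i : Fin a) × Fin (n i)) → Fin (n s.1)) → ℝ)
    (s : (i : Fin a) × Fin (n i)) (h : ∀ K, ∑ u, f (Function.update K s u) = 0) :
    ∫ K, f K ∂(indexLaw n) = 0 := by
  classical
  -- Exchanging coordinate `s` of `K` with the spare index `u` is an involution, so the sum of `f`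
  -- over all updates is `n s.1` times the sum of `f` over all `K`.
  let e : (((s : (i : Fin a) × Fin (n i)) → Fin (n s.1)) × Fin (n s.1)) ≃
      (((s : (i : Fin a) × Fin (n i)) → Fin (n s.1)) × Fin (n s.1)) :=
    Function.Involutive.toPerm (fun p => (Function.update p.1 s p.2, p.1 s)) fun p => by simp
  have h1 : ∑ p : (((s : (i : Fin a) × Fin (n i)) → Fin (n s.1)) × Fin (n s.1)),
      f (Function.update p.1 s p.2) = ∑ p : (((s : (i : Fin a) × Fin (n i)) → Fin (n s.1)) ×
        Fin (n s.1)), f p.1 := Equiv.sum_comp e fun p => f p.1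
  rw [Fintype.sum_prod_type, Fintype.sum_prod_type, Finset.sum_eq_zero fun K _ => h K] at h1
  simp only [Finset.sum_const, Finset.card_univ, Fintype.card_fin,
    nsmul_eq_mul, ← Finset.mul_sum] at h1
  have h2 : ∑ K, f K = 0 := by
    rcases mul_eq_zero.1 h1.symm with h | h
    · exact absurd (Nat.cast_eq_zero.1 h) (NeZero.ne (n s.1))
    · exact h
  rw [integral_indexLaw, h2, mul_zero]

lemma integral_abs_indexLaw_le_sqrt (f : ((s : (i : Fin a) × Fin (n i)) → Fin (n s.1)) → ℝ) :
    ∫ K, |f K| ∂(indexLaw n) ≤ √(∫ K, f K ^ 2 ∂(indexLaw n)) := by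
  refine Real.le_sqrt_of_sq_le ?_
  have h := variance_nonneg (fun K => |f K|) (indexLaw n)
  rw [variance_eq_sub (.of_discrete)] at h
  simp only [Pi.pow_apply, sq_abs] at h
  linarith

/-- An orthogonal family of `m` functions bounded by `C` has a sum with `L¹` norm at most
`√m C`. -/
lemma integral_abs_sum_indexLaw_le {α : Type*} [Fintype α]
    (f : α → ((s : (i : Fin a) × Fin (n i)) → Fin (n s.1)) → ℝ) {C : ℝ} (hC : 0 ≤ C)
    (hf : ∀ p K, |f p K| ≤ C)
    (h0 : ∀ p q, p ≠ q → ∫ K, f p K * f q K ∂(indexLaw n) = 0) :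
    ∫ K, |∑ p, f p K| ∂(indexLaw n) ≤ √(Fintype.card α) * C := by
  classical
  refine (integral_abs_indexLaw_le_sqrt _).trans ?_
  rw [← Real.sqrt_sq hC, ← Real.sqrt_mul (by positivity)]
  refine Real.sqrt_le_sqrt ?_
  simp_rw [sq (∑ p, _), Finset.sum_mul_sum]
  rw [integral_finsetSum _ fun _ _ => integrable_indexLaw _]
  simp_rw [integral_finsetSum _ fun _ _ => integrable_indexLaw _]
  have : ∀ p ∈ (Finset.univ : Finset α), ∑ q, ∫ K, f p K * f q K ∂(indexLaw n) ≤ C ^ 2 := by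
    intro p _
    rw [Finset.sum_eq_single p (fun q _ hq => h0 p q hq.symm) (by simp)]
    have : ∫ K, f p K * f p K ∂(indexLaw n) ≤ ∫ _, C ^ 2 ∂(indexLaw n) := by
      refine integral_mono (integrable_indexLaw _) (integrable_indexLaw _) fun K => ?_
      have := hf p K
      simp only [← sq]
      exact sq_le_sq' (by linarith [abs_le.1 this]) (abs_le.1 this).2
    simpa using this
  simpa using Finset.sum_le_sum this

/-- Distinct resampling indices are independent, so centred summands are orthogonal and the bound
grows like `√n` instead of `n`. -/
lemma integral_abs_sum_centered_le (g : Fin a) (f : Fin (n g) → ℝ) {C : ℝ} (hC : 0 ≤ C)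
    (hf : ∀ u, |f u| ≤ C) (h0 : ∑ u, f u = 0) :
    ∫ K, |∑ k, f (K ⟨g, k⟩)| ∂(indexLaw n) ≤ √(n g) * C := by
  have := integral_abs_sum_indexLaw_le (n := n) (fun k K => f (K ⟨g, k⟩)) hC (fun k K => hf _) ?_
  · simpa using this
  intro k r hkr
  refine integral_indexLaw_eq_zero _ ⟨g, k⟩ fun K => ?_
  have h : (⟨g, r⟩ : (i : Fin a) × Fin (n i)) ≠ ⟨g, k⟩ := by
    simpa using hkr.symm
  simp [Function.update_of_ne h, ← Finset.sum_mul, h0]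

/-- Two different index pairs differ in the row or in the column. Integrating out an index that
occurs in only one of the two factors kills their product, so all `n l * n i` terms are orthogonal.
This needs `l ≠ i`, as otherwise a row index and a column index could be the same variable. -/
lemma integral_abs_sum_doubly_centered_le {l i : Fin a} (hli : l ≠ i)
    (b : Fin (n l) → Fin (n i) → ℝ) {C : ℝ} (hC : 0 ≤ C) (hb : ∀ u v, |b u v| ≤ C)
    (h1 : ∀ v, ∑ u, b u v = 0) (h2 : ∀ u, ∑ v, b u v = 0) :
    ∫ K, |∑ k, ∑ r, b (K ⟨l, k⟩) (K ⟨i, r⟩)| ∂(indexLaw n) ≤ √((n l : ℝ) * n i) * C := by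
  have := integral_abs_sum_indexLaw_le (n := n)
    (fun (p : Fin (n l) × Fin (n i)) K => b (K ⟨l, p.1⟩) (K ⟨i, p.2⟩)) hC (fun k K => hb _ _) ?_
  · simpa [Fintype.sum_prod_type] using this
  rintro ⟨k, r⟩ ⟨k', r'⟩ hne
  have hA (u v) : (⟨i, v⟩ : (i : Fin a) × Fin (n i)) ≠ ⟨l, u⟩ := fun h => hli (by
    simpa using (congrArg Sigma.fst h).symm)
  by_cases hk : k = k'
  · have hr : r ≠ r' := fun h => hne (by simp [hk, h])
    refine integral_indexLaw_eq_zero _ ⟨i, r⟩ fun K => ?_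
    have h : (⟨i, r'⟩ : (i : Fin a) × Fin (n i)) ≠ ⟨i, r⟩ := by simpa using hr.symm
    simp [Function.update_of_ne h, Function.update_of_ne (hA _ _).symm, ← Finset.sum_mul, h2]
  · refine integral_indexLaw_eq_zero _ ⟨l, k⟩ fun K => ?_
    have h : (⟨l, k'⟩ : (i : Fin a) × Fin (n i)) ≠ ⟨l, k⟩ := by simpa using Ne.symm hk
    simp [Function.update_of_ne h, Function.update_of_ne (hA _ _), ← Finset.sum_mul, h1]

end IndexLaw

/-! ### Hoeffding decomposition and linearization -/

lemma countFun_nonneg (u : ℝ) : 0 ≤ countFun u := by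
  unfold countFun; split_ifs <;> norm_num

lemma countFun_le_one (u : ℝ) : countFun u ≤ 1 := by
  unfold countFun
  split_ifs <;> linarith

/-- The weight `1/2` at ties makes this exact for every pair; it replaces any continuity assumption
in the antisymmetry of the pairwise effects. -/
lemma countFun_add_countFun_swap (u v : ℝ) : countFun (u - v) + countFun (v - u) = 1 := by
  unfold countFun
  rcases lt_trichotomy u v with h | h | h
  · have h1 : ¬ 0 < u - v := by linarith
    have h2 : u - v ≠ 0 := by linarith
    have h3 : v - u ≠ 0 := by linarith
    simp [h, h1, h2, h3]
  · simp [h]; norm_num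
  · have h1 : ¬ 0 < v - u := by linarith
    have h2 : u - v ≠ 0 := by linarith
    have h3 : v - u ≠ 0 := by linarith
    simp [h, h1, h2, h3]

/-- The linearized influence of one observation `y` of group `g` on the effect `s`. -/
noncomputable def projFun {a d : ℕ} (F : Fin a → Fin d → ℝ → ℝ) (g : Fin a) (s : Fin a × Fin d)
    (y : Fin d → ℝ) : ℝ :=
  (1 / (a : ℝ)) * ∑ l : Fin a,
    ((if g = s.1 then F l s.2 (y s.2) else 0) - (if g = l then F s.1 s.2 (y s.2) else 0))

section Linearization

variable {a d : ℕ} {n : Fin a → ℕ} (x : (i : Fin a) → Fin (n i) → Fin d → ℝ)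

/-- The empirical pairwise Mann-Whitney effect. -/
noncomputable def pairEffect (l i : Fin a) (j : Fin d) : ℝ :=
  (1 / (n i : ℝ)) * ∑ k : Fin (n i), empCDF x l j (x i k j)

/-- The difference of the resampled and the empirical mean of `f` over group `g`. -/
noncomputable def fluct (K : (s : (i : Fin a) × Fin (n i)) → Fin (n s.1)) (g : Fin a)
    (f : (Fin d → ℝ) → ℝ) : ℝ :=
  (1 / (n g : ℝ)) * ∑ k : Fin (n g), (f (x g (K ⟨g, k⟩)) - (1 / (n g : ℝ)) * ∑ u, f (x g u))

lemma empEffect_eq_sum_pairEffect (i : Fin a) (j : Fin d) :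
    empEffect x i j = (1 / (a : ℝ)) * ∑ l, pairEffect x l i j := by
  unfold empEffect meanEmpCDF pairEffect
  simp_rw [Finset.mul_sum]
  rw [Finset.sum_comm]
  exact Finset.sum_congr rfl fun _ _ => Finset.sum_congr rfl fun _ _ => by ring

lemma empCDF_mem_Icc (i : Fin a) (j : Fin d) (t : ℝ) : empCDF x i j t ∈ Set.Icc (0 : ℝ) 1 := by
  have h1 : ∑ k : Fin (n i), countFun (t - x i k j) ≤ n i := by
    simpa using Finset.sum_le_sum fun (k : Fin (n i)) (_ : k ∈ Finset.univ) =>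
      countFun_le_one (t - x i k j)
  have h0 : 0 ≤ ∑ k : Fin (n i), countFun (t - x i k j) :=
    Finset.sum_nonneg fun k _ => countFun_nonneg _
  unfold empCDF
  refine ⟨by positivity, ?_⟩
  rw [one_div, inv_mul_eq_div]
  exact div_le_one_of_le₀ h1 (by positivity)

lemma fluct_zero (K : (s : (i : Fin a) × Fin (n i)) → Fin (n s.1)) (g : Fin a) :
    fluct x K g (fun _ => 0) = 0 := by
  simp [fluct]

variable [∀ i, NeZero (n i)]

lemma cast_size_ne_zero (i : Fin a) : (n i : ℝ) ≠ 0 := Nat.cast_ne_zero.2 (NeZero.ne _)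

lemma fluct_eq (K : (s : (i : Fin a) × Fin (n i)) → Fin (n s.1)) (g : Fin a)
    (f : (Fin d → ℝ) → ℝ) :
    fluct x K g f = (1 / (n g : ℝ)) * ∑ k, f (x g (K ⟨g, k⟩)) - (1 / (n g : ℝ)) * ∑ u, f (x g u) := by
  have := cast_size_ne_zero (n := n) g
  unfold fluct
  rw [Finset.sum_sub_distrib, mul_sub]
  congr 1
  rw [Finset.sum_const, Finset.card_univ, Fintype.card_fin, nsmul_eq_mul]
  field_simp

lemma fluct_sub (K : (s : (i : Fin a) × Fin (n i)) → Fin (n s.1)) (g : Fin a)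
    (f f' : (Fin d → ℝ) → ℝ) :
    fluct x K g (fun y => f y - f' y) = fluct x K g f - fluct x K g f' := by
  simp only [fluct_eq, Finset.sum_sub_distrib]
  ring

lemma fluct_const_mul (K : (s : (i : Fin a) × Fin (n i)) → Fin (n s.1)) (g : Fin a) (c : ℝ)
    (f : (Fin d → ℝ) → ℝ) :
    fluct x K g (fun y => c * f y) = c * fluct x K g f := by
  simp only [fluct_eq, ← Finset.mul_sum]
  ring

lemma fluct_sum {ι : Type*} (S : Finset ι) (K : (s : (i : Fin a) × Fin (n i)) → Fin (n s.1))
    (g : Fin a) (f : ι → (Fin d → ℝ) → ℝ) :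
    fluct x K g (fun y => ∑ s ∈ S, f s y) = ∑ s ∈ S, fluct x K g (f s) := by
  simp only [fluct_eq, Finset.sum_sub_distrib, ← Finset.mul_sum]
  rw [Finset.sum_comm, Finset.sum_comm (s := Finset.univ)]

lemma integral_abs_fluct_le (g : Fin a) (f : (Fin d → ℝ) → ℝ) {C : ℝ} (hC : 0 ≤ C)
    (hf : ∀ y, |f y| ≤ C) :
    ∫ K, |fluct x K g f| ∂(indexLaw n) ≤ 2 * C / √(n g) := by
  have hn := cast_size_ne_zero (n := n) g
  have hn0 : (0 : ℝ) < n g := lt_of_le_of_ne (by positivity) hn.symm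
  have hm : |(1 / (n g : ℝ)) * ∑ u, f (x g u)| ≤ C := by
    rw [abs_mul, abs_of_nonneg (by positivity), one_div, inv_mul_le_iff₀ hn0]
    refine (Finset.abs_sum_le_sum_abs _ _).trans ?_
    simpa using Finset.sum_le_sum fun (k : Fin (n g)) (_ : k ∈ Finset.univ) => hf (x g k)
  have := integral_abs_sum_centered_le (n := n) g
    (fun u => f (x g u) - (1 / (n g : ℝ)) * ∑ u, f (x g u)) (C := 2 * C) (by positivity)
    (fun u => (abs_sub _ _).trans (by linarith [hf (x g u)])) (by
      simp only [Finset.sum_sub_distrib, Finset.sum_const, Finset.card_univ, Fintype.card_fin,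
        nsmul_eq_mul]
      field_simp
      ring)
  unfold fluct
  simp_rw [abs_mul, integral_const_mul]
  rw [abs_of_nonneg (by positivity)]
  calc _ ≤ 1 / (n g : ℝ) * (√(n g) * (2 * C)) := by gcongr
    _ = 2 * C / √(n g) := by
      have h := Real.sq_sqrt hn0.le
      have h' : √(n g : ℝ) ≠ 0 := (Real.sqrt_pos.2 hn0).ne'
      field_simp
      rw [h]

lemma pairEffect_swap (l i : Fin a) (j : Fin d) :
    pairEffect x l i j + pairEffect x i l j = 1 := by
  have hi := cast_size_ne_zero (n := n) i
  have hl := cast_size_ne_zero (n := n) l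
  have h : (∑ k : Fin (n i), ∑ r : Fin (n l), countFun (x i k j - x l r j)) +
      ∑ r : Fin (n l), ∑ k : Fin (n i), countFun (x l r j - x i k j) = n i * n l := by
    rw [Finset.sum_comm (s := (Finset.univ : Finset (Fin (n l)))), ← Finset.sum_add_distrib]
    simp_rw [← Finset.sum_add_distrib, countFun_add_countFun_swap]
    simp
  unfold pairEffect empCDF
  simp_rw [← Finset.mul_sum]
  field_simp
  linarith

lemma pairEffect_self (i : Fin a) (j : Fin d) : pairEffect x i i j = 1 / 2 := by
  linarith [pairEffect_swap x i i j]

/-- The difference of the resampled and the empirical pairwise effect is, up to a degenerate term,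
a difference of two fluctuations. -/
lemma pairEffect_resample_sub (K : (s : (i : Fin a) × Fin (n i)) → Fin (n s.1)) (l i : Fin a)
    (j : Fin d) :
    pairEffect (resample x K) l i j - pairEffect x l i j =
      1 / ((n l : ℝ) * n i) * ∑ k, ∑ r, (countFun (x i (K ⟨i, r⟩) j - x l (K ⟨l, k⟩) j)
        - empCDF x l j (x i (K ⟨i, r⟩) j) - (1 - empCDF x i j (x l (K ⟨l, k⟩) j))
        + pairEffect x l i j)
      + fluct x K i (fun y => empCDF x l j (y j)) - fluct x K l (fun y => empCDF x i j (y j)) := by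
  have hi := cast_size_ne_zero (n := n) i
  have hl := cast_size_ne_zero (n := n) l
  have h1 : pairEffect (resample x K) l i j = 1 / ((n l : ℝ) * n i) *
      ∑ k, ∑ r, countFun (x i (K ⟨i, r⟩) j - x l (K ⟨l, k⟩) j) := by
    rw [Finset.sum_comm]
    unfold pairEffect empCDF resample
    simp_rw [← Finset.mul_sum]
    field_simp
  have h2 : (1 / (n i : ℝ)) * ∑ u, empCDF x l j (x i u j) = pairEffect x l i j := rfl
  have h3 : (1 / (n l : ℝ)) * ∑ u, empCDF x i j (x l u j) = 1 - pairEffect x l i j := by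
    exact eq_sub_of_add_eq' (pairEffect_swap x l i j)
  rw [h1, fluct_eq, fluct_eq, h2, h3]
  simp only [Finset.sum_sub_distrib, Finset.sum_add_distrib, Finset.sum_const, Finset.card_univ,
    Fintype.card_fin, nsmul_eq_mul, ← Finset.mul_sum]
  field_simp
  ring

lemma integral_abs_pairEffect_sub_le (F : Fin a → Fin d → ℝ → ℝ) {ε : ℝ}
    (hF : ∀ i j t, |empCDF x i j t - F i j t| ≤ ε) (l i : Fin a) (j : Fin d) :
    ∫ K, |pairEffect (resample x K) l i j - pairEffect x l i j
        - (fluct x K i (fun y => F l j (y j)) - fluct x K l (fun y => F i j (y j)))| ∂(indexLaw n)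
      ≤ 4 / √((n l : ℝ) * n i) + 2 * ε / √(n i) + 2 * ε / √(n l) := by
  have hi := cast_size_ne_zero (n := n) i
  have hl := cast_size_ne_zero (n := n) l
  have hε : 0 ≤ ε := (abs_nonneg _).trans (hF i j 0)
  -- Within a single group the doubly centred bound is not available, but there both pairwise
  -- effects equal `1/2` and the two fluctuations cancel.
  by_cases hli : l = i
  · subst hli
    simp only [pairEffect_self, sub_self, abs_zero, integral_zero]
    positivity
  set b : Fin (n l) → Fin (n i) → ℝ := fun u v => countFun (x i v j - x l u j)
    - empCDF x l j (x i v j) - (1 - empCDF x i j (x l u j)) + pairEffect x l i j with hb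
  have hw : pairEffect x l i j ∈ Set.Icc (0 : ℝ) 1 := by
    have h1 := pairEffect_swap x l i j
    have h (l i) : 0 ≤ pairEffect x l i j :=
      mul_nonneg (by positivity) (Finset.sum_nonneg fun k _ => (empCDF_mem_Icc x _ _ _).1)
    exact ⟨h l i, by linarith [h i l]⟩
  have hbC u v : |b u v| ≤ 4 := by
    have h1 := countFun_nonneg (x i v j - x l u j)
    have h2 := countFun_le_one (x i v j - x l u j)
    have h3 := empCDF_mem_Icc x l j (x i v j)
    have h4 := empCDF_mem_Icc x i j (x l u j)
    obtain ⟨h3, h3'⟩ := h3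
    obtain ⟨h4, h4'⟩ := h4
    obtain ⟨h5, h5'⟩ := hw
    simp only [hb, abs_le]
    constructor <;> linarith
  have h2 : ∑ u, empCDF x l j (x i u j) = n i * pairEffect x l i j := by
    unfold pairEffect; field_simp
  have h3 : ∑ u, empCDF x i j (x l u j) = n l * (1 - pairEffect x l i j) := by
    rw [← pairEffect_swap x l i j, add_sub_cancel_left]
    unfold pairEffect; field_simp
  have h4 v : ∑ u, countFun (x i v j - x l u j) = n l * empCDF x l j (x i v j) := by
    unfold empCDF; field_simp
  have h5 u : ∑ v, countFun (x i v j - x l u j) = n i * (1 - empCDF x i j (x l u j)) := by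
    have : ∀ v, countFun (x i v j - x l u j) = 1 - countFun (x l u j - x i v j) := fun v => by
      linarith [countFun_add_countFun_swap (x i v j) (x l u j)]
    simp_rw [this, Finset.sum_sub_distrib]
    unfold empCDF
    simp
    field_simp
  -- Averaging `countFun` over either argument gives an empirical distribution function or its
  -- complement, so row and column sums of the Hoeffding remainder `b` vanish.
  have hb1 v : ∑ u, b u v = 0 := by
    simp only [hb, Finset.sum_sub_distrib, Finset.sum_add_distrib, Finset.sum_const,
      Finset.card_univ, Fintype.card_fin, nsmul_eq_mul, h3, h4]
    ring
  have hb2 u : ∑ v, b u v = 0 := by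
    simp only [hb, Finset.sum_sub_distrib, Finset.sum_add_distrib, Finset.sum_const,
      Finset.card_univ, Fintype.card_fin, nsmul_eq_mul, h2, h5]
    ring
  -- The error is the degenerate term plus the fluctuations of `empCDF - F`, which are small because
  -- these functions are uniformly bounded by `ε`.
  have key K : pairEffect (resample x K) l i j - pairEffect x l i j
        - (fluct x K i (fun y => F l j (y j)) - fluct x K l (fun y => F i j (y j))) =
      1 / ((n l : ℝ) * n i) * ∑ k, ∑ r, b (K ⟨l, k⟩) (K ⟨i, r⟩)
      + fluct x K i (fun y => empCDF x l j (y j) - F l j (y j))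
      - fluct x K l (fun y => empCDF x i j (y j) - F i j (y j)) := by
    rw [pairEffect_resample_sub, fluct_sub, fluct_sub]
    ring
  have hB : ∫ K, |1 / ((n l : ℝ) * n i) * ∑ k, ∑ r, b (K ⟨l, k⟩) (K ⟨i, r⟩)| ∂(indexLaw n)
      ≤ 4 / √((n l : ℝ) * n i) := by
    simp_rw [abs_mul, integral_const_mul]
    rw [abs_of_nonneg (by positivity)]
    calc _ ≤ 1 / ((n l : ℝ) * n i) * (√((n l : ℝ) * n i) * 4) := by
          gcongr
          exact integral_abs_sum_doubly_centered_le hli b (by norm_num) hbC hb1 hb2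
      _ = _ := by
        have hn0 : (0 : ℝ) < (n l : ℝ) * n i := lt_of_le_of_ne (by positivity) (by positivity)
        have h := Real.sq_sqrt hn0.le
        have h' : √((n l : ℝ) * n i) ≠ 0 := (Real.sqrt_pos.2 hn0).ne'
        rw [div_mul_eq_mul_div, one_mul, div_eq_div_iff hn0.ne' h', mul_right_comm, ← sq, h]
        ring
  have h1 := integral_abs_fluct_le x i (fun y => empCDF x l j (y j) - F l j (y j)) hε
    fun y => hF _ _ _
  have h2 := integral_abs_fluct_le x l (fun y => empCDF x i j (y j) - F i j (y j)) hε
    fun y => hF _ _ _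
  simp_rw [key]
  calc _ ≤ ∫ K, (|1 / ((n l : ℝ) * n i) * ∑ k, ∑ r, b (K ⟨l, k⟩) (K ⟨i, r⟩)|
      + |fluct x K i (fun y => empCDF x l j (y j) - F l j (y j))|
      + |fluct x K l (fun y => empCDF x i j (y j) - F i j (y j))|) ∂(indexLaw n) :=
        integral_mono (integrable_indexLaw _) (integrable_indexLaw _) fun K =>
          (abs_sub _ _).trans (by gcongr; exact abs_add_le _ _)
    _ ≤ _ := by
      rw [integral_add (integrable_indexLaw _) (integrable_indexLaw _),
        integral_add (integrable_indexLaw _) (integrable_indexLaw _)]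
      gcongr

/-- Regrouping the linear terms by the group of the observation makes the summands independent
across `g`. -/
lemma sum_fluct_projFun (F : Fin a → Fin d → ℝ → ℝ)
    (K : (s : (i : Fin a) × Fin (n i)) → Fin (n s.1)) (s : Fin a × Fin d) :
    ∑ g, fluct x K g (projFun F g s) = (1 / (a : ℝ)) * ∑ l,
      (fluct x K s.1 (fun y => F l s.2 (y s.2)) - fluct x K l (fun y => F s.1 s.2 (y s.2))) := by
  unfold projFun
  simp_rw [fluct_const_mul, fluct_sum, ← Finset.mul_sum, fluct_sub]
  rw [Finset.sum_comm]
  congr 1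
  refine Finset.sum_congr rfl fun l _ => ?_
  rw [Finset.sum_sub_distrib, Finset.sum_eq_single s.1 _ (by simp), Finset.sum_eq_single l _ (by simp)]
  · simp
  · intro g _ hg; simp [hg, fluct_zero]
  · intro g _ hg; simp [hg, fluct_zero]

lemma integral_abs_empEffect_sub_le (F : Fin a → Fin d → ℝ → ℝ) {ε : ℝ}
    (hF : ∀ i j t, |empCDF x i j t - F i j t| ≤ ε) (s : Fin a × Fin d) :
    ∫ K, |empEffect (resample x K) s.1 s.2 - empEffect x s.1 s.2
        - ∑ g, fluct x K g (projFun F g s)| ∂(indexLaw n)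
      ≤ (1 / (a : ℝ)) * ∑ l,
        (4 / √((n l : ℝ) * n s.1) + 2 * ε / √(n s.1) + 2 * ε / √(n l)) := by
  simp_rw [sum_fluct_projFun, empEffect_eq_sum_pairEffect, ← mul_sub, ← Finset.sum_sub_distrib,
    abs_mul, integral_const_mul]
  rw [abs_of_nonneg (by positivity)]
  gcongr
  calc _ ≤ ∫ K, ∑ l, |pairEffect (resample x K) l s.1 s.2 - pairEffect x l s.1 s.2
        - (fluct x K s.1 (fun y => F l s.2 (y s.2)) - fluct x K l (fun y => F s.1 s.2 (y s.2)))|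
          ∂(indexLaw n) :=
        integral_mono (integrable_indexLaw _) (integrable_indexLaw _) fun K =>
          Finset.abs_sum_le_sum_abs _ _
    _ ≤ _ := by
      rw [integral_finsetSum _ fun _ _ => integrable_indexLaw _]
      exact Finset.sum_le_sum fun l _ => integral_abs_pairEffect_sub_le x F hF l s.1 s.2

end Linearization

/-! ### Central limit theorem for resampling, by characteristic functions -/

/-- Since `log (1 + z) - z` is of order `|z|²`, multiplying by `k` leaves an error of order `|k z|
|z|`, which tends to `0`. -/
lemma tendsto_one_add_pow_exp {ι : Type*} {L : Filter ι} {k : ι → ℕ} {z : ι → ℂ} {w : ℂ}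
    (hk : Tendsto k L atTop) (hz : Tendsto (fun m => (k m : ℂ) * z m) L (𝓝 w)) :
    Tendsto (fun m => (1 + z m) ^ k m) L (𝓝 (Complex.exp w)) := by
  have hz0 : Tendsto z L (𝓝 0) := by
    have h1 : Tendsto (fun m => ((k m : ℂ))⁻¹) L (𝓝 0) :=
      (tendsto_inv₀_cobounded (α := ℂ)).comp (tendsto_natCast_atTop_cobounded.comp hk)
    have h2 := h1.mul hz
    rw [zero_mul] at h2
    refine h2.congr' ?_
    filter_upwards [hk.eventually_ne_atTop 0] with m hm
    have : (k m : ℂ) ≠ 0 := Nat.cast_ne_zero.2 hm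
    field_simp
  have hsmall : ∀ᶠ m in L, ‖z m‖ < 1 / 2 := by
    have := hz0.norm
    rw [norm_zero] at this
    exact this.eventually_lt_const (by norm_num)
  have hlog : Tendsto (fun m => (k m : ℂ) * Complex.log (1 + z m)) L (𝓝 w) := by
    have h0 : Tendsto (fun m => (k m : ℂ) * (Complex.log (1 + z m) - z m)) L (𝓝 0) := by
      have h1 : Tendsto (fun m => ‖(k m : ℂ) * z m‖ * ‖z m‖) L (𝓝 0) := by
        simpa using hz.norm.mul hz0.norm
      refine squeeze_zero_norm' ?_ h1
      filter_upwards [hsmall] with m hm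
      have h2 := Complex.norm_log_one_add_sub_self_le (z := z m) (by linarith)
      have h3 : (1 - ‖z m‖)⁻¹ ≤ 2 := by
        rw [inv_le_comm₀ (by linarith) (by norm_num)]
        linarith
      have h4 : ‖Complex.log (1 + z m) - z m‖ ≤ ‖z m‖ ^ 2 := by
        have : ‖z m‖ ^ 2 * (1 - ‖z m‖)⁻¹ ≤ ‖z m‖ ^ 2 * 2 := by gcongr
        linarith
      rw [norm_mul, norm_mul]
      calc _ ≤ ‖(k m : ℂ)‖ * ‖z m‖ ^ 2 := by gcongr
        _ = _ := by ring
    have := h0.add hz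
    rw [zero_add] at this
    exact this.congr fun m => by ring
  refine ((Complex.continuous_exp.tendsto w).comp hlog).congr' ?_
  filter_upwards [hsmall] with m hm
  have hne : 1 + z m ≠ 0 := fun h => by
    have : z m = -1 := by linear_combination h
    rw [this] at hm
    norm_num at hm
  simp only [Function.comp]
  rw [Complex.exp_nat_mul, Complex.exp_log hne]

lemma norm_exp_mul_I_sub_le {θ : ℝ} (hθ : |θ| ≤ 1) :
    ‖Complex.exp (θ * Complex.I) - (1 + θ * Complex.I - (θ : ℂ) ^ 2 / 2)‖ ≤ |θ| ^ 3 := by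
  have hn : ‖(θ : ℂ) * Complex.I‖ = |θ| := by simp
  have h := Complex.exp_bound (x := (θ : ℂ) * Complex.I) (by rwa [hn]) (n := 3) (by norm_num)
  rw [hn] at h
  have h2 : ∑ m ∈ Finset.range 3, ((θ : ℂ) * Complex.I) ^ m / (m.factorial : ℂ) =
      1 + θ * Complex.I - (θ : ℂ) ^ 2 / 2 := by
    simp [Finset.sum_range_succ, mul_pow, Complex.I_sq]
    ring
  rw [h2] at h
  refine h.trans ?_
  have : ((Nat.succ 3 : ℕ) : ℝ) * (((Nat.factorial 3 : ℕ) : ℝ) * ((3 : ℕ) : ℝ))⁻¹ ≤ 1 := by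
    norm_num [Nat.factorial]
  exact mul_le_of_le_one_right (by positivity) this

/-- The characteristic function form of the central limit theorem for resampling from a centred
bounded triangular array. -/
lemma tendsto_mean_exp_pow {k : ℕ → ℕ} (hk : Tendsto k atTop atTop) (y : (m : ℕ) → Fin (k m) → ℝ)
    (θ : ℕ → ℝ) {C c v : ℝ} (hy : ∀ m u, |y m u| ≤ C) (h0 : ∀ m, ∑ u, y m u = 0)
    (hθ : Tendsto (fun m => k m * θ m ^ 2) atTop (𝓝 c))
    (hv : Tendsto (fun m => (k m : ℝ)⁻¹ * ∑ u, y m u ^ 2) atTop (𝓝 v)) :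
    Tendsto (fun m => ((k m : ℂ)⁻¹ * ∑ u, Complex.exp ((θ m * y m u : ℝ) * Complex.I)) ^ k m)
      atTop (𝓝 (Complex.exp (-(c * v / 2 : ℝ)))) := by
  have hkr : Tendsto (fun m => ((k m : ℝ))⁻¹) atTop (𝓝 0) :=
    tendsto_inv_atTop_zero.comp (tendsto_natCast_atTop_atTop.comp hk)
  have hne : ∀ᶠ m in atTop, k m ≠ 0 := hk.eventually_ne_atTop 0
  have hθ0 : Tendsto (fun m => |θ m|) atTop (𝓝 0) := by
    have h1 := (hkr.mul hθ).sqrt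
    rw [zero_mul, Real.sqrt_zero] at h1
    refine h1.congr' ?_
    filter_upwards [hne] with m hm
    have : (k m : ℝ) ≠ 0 := Nat.cast_ne_zero.2 hm
    rw [← mul_assoc, inv_mul_cancel₀ this, one_mul, Real.sqrt_sq_eq_abs]
  have hsmall : ∀ᶠ m in atTop, ∀ u, |θ m * y m u| ≤ 1 := by
    have h1 : Tendsto (fun m => |θ m| * |C|) atTop (𝓝 0) := by simpa using hθ0.mul_const |C|
    filter_upwards [h1.eventually_le_const one_pos] with m hm u
    rw [abs_mul]
    exact (mul_le_mul_of_nonneg_left ((hy m u).trans (le_abs_self C)) (abs_nonneg _)).trans hm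
  -- The summed Taylor remainders are at most `k |θ C|³ = (k θ²) |θ| |C|³`, and `θ → 0` because `k
  -- θ²` converges while `k → ∞`.
  have herr : Tendsto (fun m => ∑ u, (Complex.exp ((θ m * y m u : ℝ) * Complex.I)
      - (1 + (θ m * y m u : ℝ) * Complex.I - ((θ m * y m u : ℝ) : ℂ) ^ 2 / 2))) atTop (𝓝 0) := by
    have h1 : Tendsto (fun m => (k m * θ m ^ 2) * |θ m| * |C| ^ 3) atTop (𝓝 0) := by
      simpa using (hθ.mul hθ0).mul_const (|C| ^ 3)
    refine squeeze_zero_norm' ?_ h1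
    filter_upwards [hsmall] with m hm
    refine (norm_sum_le _ _).trans ?_
    have : ∀ u ∈ (Finset.univ : Finset (Fin (k m))),
        ‖Complex.exp ((θ m * y m u : ℝ) * Complex.I)
      - (1 + (θ m * y m u : ℝ) * Complex.I - ((θ m * y m u : ℝ) : ℂ) ^ 2 / 2)‖
        ≤ (|θ m| * |C|) ^ 3 := fun u _ => by
      refine (norm_exp_mul_I_sub_le (hm u)).trans ?_
      rw [abs_mul]
      exact pow_le_pow_left₀ (by positivity)
        (mul_le_mul_of_nonneg_left ((hy m u).trans (le_abs_self C)) (abs_nonneg _)) 3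
    refine (Finset.sum_le_sum this).trans (le_of_eq ?_)
    simp only [Finset.sum_const, Finset.card_univ, Fintype.card_fin, nsmul_eq_mul]
    rw [← sq_abs (θ m)]
    ring
  have hmain : Tendsto (fun m => ((-((k m * θ m ^ 2) * ((k m : ℝ)⁻¹ * ∑ u, y m u ^ 2) / 2) : ℝ) : ℂ))
      atTop (𝓝 ((-(c * v / 2) : ℝ))) :=
    (Complex.continuous_ofReal.tendsto _).comp (((hθ.mul hv).div_const 2).neg)
  have hlim := herr.add hmain
  rw [zero_add] at hlim
  -- The base is `1 + z`, where `k z` is the Taylor remainder plus the second-order term; the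
  -- first-order term vanishes by centring.
  have hz := tendsto_one_add_pow_exp (z := fun m =>
    (k m : ℂ)⁻¹ * ∑ u, Complex.exp ((θ m * y m u : ℝ) * Complex.I) - 1) hk (w := _)
    (hlim.congr' ?_)
  · simpa using hz
  filter_upwards [hne] with m hm
  have hm' : (k m : ℂ) ≠ 0 := Nat.cast_ne_zero.2 hm
  have hm'' : (k m : ℝ) ≠ 0 := Nat.cast_ne_zero.2 hm
  have e1 : ((-((k m * θ m ^ 2) * ((k m : ℝ)⁻¹ * ∑ u, y m u ^ 2) / 2) : ℝ) : ℂ) =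
      -((θ m : ℂ) ^ 2 / 2 * ∑ u, (y m u : ℂ) ^ 2) := by
    push_cast
    field_simp
  have e2 : ∑ u, (y m u : ℂ) = 0 := by exact_mod_cast congrArg (fun r : ℝ => (r : ℂ)) (h0 m)
  have e3 : ∑ u, ((θ m * y m u : ℝ) : ℂ) * Complex.I = 0 := by
    push_cast
    rw [← Finset.sum_mul, ← Finset.mul_sum, e2]
    ring
  have e4 : ∑ u, ((θ m * y m u : ℝ) : ℂ) ^ 2 / 2 = (θ m : ℂ) ^ 2 / 2 * ∑ u, (y m u : ℂ) ^ 2 := by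
    rw [Finset.mul_sum]
    exact Finset.sum_congr rfl fun u _ => by push_cast; ring
  rw [e1, Finset.sum_sub_distrib, Finset.sum_sub_distrib, Finset.sum_add_distrib, e3, e4]
  rw [Finset.sum_const, Finset.card_univ, Fintype.card_fin, nsmul_eq_mul, mul_sub,
    mul_inv_cancel_left₀ hm']
  ring

section CharFun

variable {a d : ℕ} {n : Fin a → ℕ} [∀ i, NeZero (n i)]

lemma integral_exp_sum_indexLaw (f : (g : Fin a) → Fin (n g) → ℂ) :
    ∫ K, Complex.exp (∑ g, ∑ k, f g (K ⟨g, k⟩)) ∂(indexLaw n) =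
      ∏ g, ((n g : ℂ)⁻¹ * ∑ u, Complex.exp (f g u)) ^ n g := by
  have (s : (i : Fin a) × Fin (n i)) :
      IsProbabilityMeasure (uniformOn (Set.univ : Set (Fin (n s.1)))) :=
    isProbabilityMeasure_uniformOn Set.finite_univ Set.univ_nonempty
  have h (K : (s : (i : Fin a) × Fin (n i)) → Fin (n s.1)) :
      Complex.exp (∑ g, ∑ k, f g (K ⟨g, k⟩)) = ∏ s, Complex.exp (f s.1 (K s)) := by
    rw [← Complex.exp_sum, Fintype.sum_sigma]
  simp_rw [h]
  unfold indexLaw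
  rw [integral_fintype_prod_eq_prod (f := fun (s : (i : Fin a) × Fin (n i)) u =>
    Complex.exp (f s.1 u)), Fintype.prod_sigma]
  refine Finset.prod_congr rfl fun g _ => ?_
  simp_rw [integral_uniformOn_univ]
  simp

/-- The vector of linearized, normalized resampling deviations. -/
noncomputable def linStat (x : (i : Fin a) → Fin (n i) → Fin d → ℝ) (F : Fin a → Fin d → ℝ → ℝ)
    (K : (s : (i : Fin a) × Fin (n i)) → Fin (n s.1)) : EuclideanSpace ℝ (Fin a × Fin d) :=
  WithLp.toLp 2 fun s : Fin a × Fin d =>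
    √((∑ i, n i : ℕ) : ℝ) * ∑ g, fluct x K g (projFun F g s)

/-- Pairing with `t` turns the vector into sums of one scalar function per group, as in the
Cramér-Wold device; independence of the indices then factors the expectation. -/
lemma charFun_linStat (x : (i : Fin a) → Fin (n i) → Fin d → ℝ) (F : Fin a → Fin d → ℝ → ℝ)
    (t : EuclideanSpace ℝ (Fin a × Fin d)) :
    charFun ((indexLaw n).map (linStat x F)) t =
      ∏ g, ((n g : ℂ)⁻¹ * ∑ u, Complex.exp (((√((∑ i, n i : ℕ) : ℝ) / n g) *
        (∑ s, t s * projFun F g s (x g u) -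
          (1 / (n g : ℝ)) * ∑ v, ∑ s, t s * projFun F g s (x g v)) : ℝ) * Complex.I)) ^ n g := by
  rw [charFun_apply, integral_map (Measurable.of_discrete.aemeasurable)
    (by fun_prop), ← integral_exp_sum_indexLaw]
  congr with K
  congr 1
  simp_rw [← Finset.sum_mul]
  congr 1
  rw [PiLp.inner_apply]
  norm_cast
  simp only [linStat, RCLike.inner_apply, conj_trivial, ← mul_assoc, mul_comm _ (√_)]
  simp_rw [mul_assoc, div_eq_mul_one_div (√_), mul_assoc, ← Finset.mul_sum]
  congr 1
  simp_rw [Finset.mul_sum, ← fluct_const_mul]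
  rw [Finset.sum_comm]
  refine Finset.sum_congr rfl fun g _ => ?_
  rw [← fluct_sum]
  unfold fluct
  simp only [Finset.mul_sum]

end CharFun

/-! ### The bounded Lipschitz distance -/

section BoundedLipschitz

variable {E : Type*} [MeasurableSpace E]

lemma blDist_triangle [PseudoEMetricSpace E] (μ ν κ : Measure E) :
    blDist μ κ ≤ blDist μ ν + blDist ν κ := by
  refine iSup_le fun h => ?_
  calc ENNReal.ofReal |∫ x, h.1 x ∂μ - ∫ x, h.1 x ∂κ|
      ≤ ENNReal.ofReal (|∫ x, h.1 x ∂μ - ∫ x, h.1 x ∂ν| + |∫ x, h.1 x ∂ν - ∫ x, h.1 x ∂κ|) :=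
        ENNReal.ofReal_le_ofReal (abs_sub_le _ _ _)
    _ ≤ _ := by
      rw [ENNReal.ofReal_add (abs_nonneg _) (abs_nonneg _)]
      exact add_le_add (le_iSup (fun h : {h : E → ℝ // LipschitzWith 1 h ∧ ∀ x, |h x| ≤ 1} =>
        ENNReal.ofReal |∫ x, h.1 x ∂μ - ∫ x, h.1 x ∂ν|) h)
        (le_iSup (fun h : {h : E → ℝ // LipschitzWith 1 h ∧ ∀ x, |h x| ≤ 1} =>
        ENNReal.ofReal |∫ x, h.1 x ∂ν - ∫ x, h.1 x ∂κ|) h)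

/-- Both laws are images of the same `μ`, so `(f, g)` is a coupling and the Lipschitz bound applies
pointwise. -/
lemma blDist_map_le [PseudoMetricSpace E] [BorelSpace E] {Ω' : Type*} [MeasurableSpace Ω']
    (μ : Measure Ω') [IsFiniteMeasure μ] {f g : Ω' → E} (hf : Measurable f) (hg : Measurable g)
    (hfg : Integrable (fun ω => dist (f ω) (g ω)) μ) :
    blDist (μ.map f) (μ.map g) ≤ ENNReal.ofReal (∫ ω, dist (f ω) (g ω) ∂μ) := by
  refine iSup_le fun ⟨h, hl, hb⟩ => ENNReal.ofReal_le_ofReal ?_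
  have hm : Measurable h := hl.continuous.measurable
  have hi {f : Ω' → E} (hf : Measurable f) : Integrable (fun ω => h (f ω)) μ :=
    .of_bound (hm.comp hf).aestronglyMeasurable 1 (.of_forall fun ω => hb _)
  rw [integral_map hf.aemeasurable hm.aestronglyMeasurable,
    integral_map hg.aemeasurable hm.aestronglyMeasurable, ← integral_sub (hi hf) (hi hg)]
  refine (abs_integral_le_integral_abs).trans (integral_mono ((hi hf).sub (hi hg)).abs hfg ?_)
  intro ω
  simpa [Real.dist_eq] using hl.dist_le_mul (f ω) (g ω)

/-- Layer-cake comparison for `f = h + 1 ≥ 0`: since `h` is `1`-Lipschitz, the `ε`-thickening of `{t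
≤ f}` lies in `{t ≤ f + ε}`. The Lévy-Prokhorov bound costs `ε ‖f‖ ≤ 2 ε` and the shift costs
another `ε`. -/
lemma integral_sub_le_of_levyProkhorovEDist_lt [PseudoMetricSpace E] [BorelSpace E]
    (μ ν : Measure E) [IsProbabilityMeasure μ] [IsProbabilityMeasure ν] {ε : ℝ} (hε : 0 < ε)
    (hμν : levyProkhorovEDist μ ν < ENNReal.ofReal ε) {h : E → ℝ} (hl : LipschitzWith 1 h)
    (hb : ∀ x, |h x| ≤ 1) :
    ∫ x, h x ∂μ - ∫ x, h x ∂ν ≤ 3 * ε := by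
  let f : BoundedContinuousFunction E ℝ :=
    BoundedContinuousFunction.ofNormedAddCommGroup (fun x => h x + 1)
      (hl.continuous.add continuous_const) 2 fun x => by
        rw [Real.norm_eq_abs, abs_le]
        constructor <;> linarith [(abs_le.1 (hb x)).1, (abs_le.1 (hb x)).2]
  let f' : BoundedContinuousFunction E ℝ := f + BoundedContinuousFunction.const E ε
  have hf0 (x : E) : 0 ≤ f x := by
    change 0 ≤ h x + 1
    linarith [(abs_le.1 (hb x)).1]
  have hf' (x : E) : f' x = f x + ε := rfl
  have hf2 : ‖f‖ ≤ 2 := BoundedContinuousFunction.norm_ofNormedAddCommGroup_le _ (by norm_num) _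
  have hff' : ‖f‖ ≤ ‖f'‖ := by
    refine (BoundedContinuousFunction.norm_le (norm_nonneg _)).2 fun x => ?_
    refine le_trans ?_ (f'.norm_coe_le_norm x)
    rw [hf', Real.norm_of_nonneg (hf0 x), Real.norm_of_nonneg (by linarith [hf0 x])]
    linarith
  have hint (μ : Measure E) [IsProbabilityMeasure μ] : Integrable h μ :=
    .of_bound hl.continuous.measurable.aestronglyMeasurable 1 (.of_forall fun ω => hb _)
  have h1 := BoundedContinuousFunction.integral_le_of_levyProkhorovEDist_lt μ ν hε hμν f
    (.of_forall hf0)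
  have h2 : ∫ t in Set.Ioc 0 ‖f‖, ν.real (Metric.thickening ε {a | t ≤ f a}) ≤
      ∫ x, f' x ∂ν := by
    rw [BoundedContinuousFunction.integral_eq_integral_meas_le f' ν
      (.of_forall fun x => by simpa [hf'] using add_nonneg (hf0 x) hε.le)]
    have hanti : Antitone fun t => ν.real (Metric.thickening ε {a | t ≤ f a}) := fun s t hst =>
      measureReal_mono (Metric.thickening_subset_of_subset _ fun x hx => le_trans hst hx)
    have hanti' : Antitone fun t => ν.real {a | t ≤ f' a} := fun s t hst =>
      measureReal_mono fun x hx => le_trans hst hx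
    have hI {φ : ℝ → ℝ} (hφ : Antitone φ) (b : ℝ) : IntegrableOn φ (Set.Ioc 0 b) :=
      ((hφ.antitoneOn _).integrableOn_isCompact isCompact_Icc).mono_set Set.Ioc_subset_Icc_self
    calc _ ≤ ∫ t in Set.Ioc 0 ‖f‖, ν.real {a | t ≤ f' a} := by
          refine integral_mono (hI hanti _) (hI hanti' _) fun t => measureReal_mono fun x hx => ?_
          obtain ⟨z, hz, hxz⟩ := Metric.mem_thickening_iff.1 hx
          have h3 := hl.dist_le_mul x z
          rw [Real.dist_eq, NNReal.coe_one, one_mul] at h3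
          have h4 := (abs_le.1 h3).1
          change t ≤ h z + 1 at hz
          change t ≤ h x + 1 + ε
          linarith
      _ ≤ _ := setIntegral_mono_set (hI hanti' _) (.of_forall fun t => measureReal_nonneg)
          (Set.Ioc_subset_Ioc_right hff').eventuallyLE
  have h3 : ∫ x, f x ∂μ = ∫ x, h x ∂μ + 1 := by
    change ∫ x, (h x + 1) ∂μ = _
    rw [integral_add (hint μ) (integrable_const _)]
    simp
  have h4 : ∫ x, f' x ∂ν = ∫ x, h x ∂ν + 1 + ε := by
    change ∫ x, (h x + 1 + ε) ∂ν = _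
    simp_rw [add_assoc]
    rw [integral_add (hint ν) (integrable_const _)]
    simp
  nlinarith

/-- Weak convergence implies convergence in the bounded Lipschitz distance. -/
lemma tendsto_blDist_of_tendsto [PseudoMetricSpace E] [BorelSpace E]
    [TopologicalSpace.SeparableSpace E] {ι : Type*} {L : Filter ι} {μ : ι → ProbabilityMeasure E}
    {ν : ProbabilityMeasure E} (h : Tendsto μ L (𝓝 ν)) :
    Tendsto (fun m => blDist (μ m : Measure E) ν) L (𝓝 0) := by
  -- On a separable space, weak convergence implies convergence in the Lévy-Prokhorov distance.
  have h1 := (LevyProkhorov.continuous_ofMeasure_probabilityMeasure.tendsto ν).comp h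
  rw [tendsto_iff_edist_tendsto_0] at h1
  rw [ENNReal.tendsto_nhds_zero]
  intro δ hδ
  obtain ⟨ε, hε0, hε⟩ : ∃ ε : ℝ, 0 < ε ∧ ENNReal.ofReal (3 * ε) ≤ δ := by
    rcases eq_or_ne δ ∞ with rfl | hδ'
    · exact ⟨1, one_pos, le_top⟩
    · exact ⟨δ.toReal / 3, div_pos (ENNReal.toReal_pos hδ.ne' hδ') (by norm_num), by
        rw [mul_div_cancel₀ _ (by norm_num), ENNReal.ofReal_toReal hδ']⟩
  filter_upwards [h1.eventually_lt_const (ENNReal.ofReal_pos.2 hε0)] with m hm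
  have hm' : levyProkhorovEDist (μ m : Measure E) ν < ENNReal.ofReal ε := hm
  refine le_trans (iSup_le fun ⟨f, hl, hb⟩ => ENNReal.ofReal_le_ofReal ?_) hε
  refine abs_sub_le_iff.2 ⟨integral_sub_le_of_levyProkhorovEDist_lt _ _ hε0 hm' hl hb,
    integral_sub_le_of_levyProkhorovEDist_lt _ _ hε0 ?_ hl hb⟩
  rwa [levyProkhorovEDist_comm]

/-- The bounded Lipschitz distance of the law of a random element with finitely many values is a
measurable function of these values. -/
lemma measurable_blDist_map [PseudoMetricSpace E] [BorelSpace E] [SecondCountableTopology E]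
    {κ : Type*} [Fintype κ] [MeasurableSpace κ] [DiscreteMeasurableSpace κ] (μ : Measure κ)
    [IsFiniteMeasure μ] (ν : Measure E) :
    Measurable fun y : κ → E => blDist (μ.map y) ν := by
  -- The supremum is over an uncountable family, so measurability is obtained from lower
  -- semicontinuity: for each `h` the expression is continuous in the finitely many values `y K`.
  have : LowerSemicontinuous fun y : κ → E => blDist (μ.map y) ν := by
    unfold blDist
    refine lowerSemicontinuous_iSup fun h => Continuous.lowerSemicontinuous ?_
    have e (y : κ → E) : ∫ x, h.1 x ∂(μ.map y) = ∑ K, μ.real {K} * h.1 (y K) := by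
      rw [integral_map Measurable.of_discrete.aemeasurable
        h.2.1.continuous.measurable.aestronglyMeasurable, integral_fintype .of_finite]
      rfl
    simp_rw [e]
    have hc := h.2.1.continuous
    exact ENNReal.continuous_ofReal.comp (by fun_prop)
  exact this.measurable

end BoundedLipschitz

/-! ### Glivenko-Cantelli with arbitrary ties -/

section GlivenkoCantelli

/-- Continuity of `ν` from below. With its right-hand counterpart below, every `x` gets a
neighbourhood whose two open halves have mass at most `ε`, whatever the atom at `x`. -/
lemma exists_lt_measureReal_Iio_le (ν : Measure ℝ) [IsProbabilityMeasure ν] (x : ℝ) {ε : ℝ}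
    (hε : 0 < ε) : ∃ l < x, ν.real (Set.Iio x) ≤ ν.real (Set.Iic l) + ε := by
  have hmono : Monotone fun k : ℕ => Set.Iic (x - 1 / ((k : ℝ) + 1)) := fun k m hkm =>
    Set.Iic_subset_Iic.2 (by
      have : 1 / ((m : ℝ) + 1) ≤ 1 / ((k : ℝ) + 1) := Nat.one_div_le_one_div hkm
      linarith)
  have hU : ⋃ k : ℕ, Set.Iic (x - 1 / ((k : ℝ) + 1)) = Set.Iio x := by
    ext y
    simp only [Set.mem_iUnion, Set.mem_Iic, Set.mem_Iio]
    refine ⟨fun ⟨k, hk⟩ => ?_, fun hy => ?_⟩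
    · have : 0 < 1 / ((k : ℝ) + 1) := Nat.one_div_pos_of_nat
      linarith
    · obtain ⟨k, hk⟩ := exists_nat_one_div_lt (sub_pos.2 hy)
      exact ⟨k, by linarith⟩
  have h := tendsto_measure_iUnion_atTop (μ := ν) hmono
  rw [hU] at h
  have h' := (ENNReal.tendsto_toReal (measure_ne_top ν (Set.Iio x))).comp h
  obtain ⟨k, hk⟩ := (h'.eventually_const_lt
    (show ν.real (Set.Iio x) - ε < ν.real (Set.Iio x) by linarith)).exists
  refine ⟨x - 1 / ((k : ℝ) + 1), ?_, ?_⟩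
  · have : 0 < 1 / ((k : ℝ) + 1) := Nat.one_div_pos_of_nat
    linarith
  · have : ν.real (Set.Iio x) - ε < ν.real (Set.Iic (x - 1 / ((k : ℝ) + 1))) := hk
    linarith

lemma exists_gt_measureReal_Iio_le (ν : Measure ℝ) [IsProbabilityMeasure ν] (x : ℝ) {ε : ℝ}
    (hε : 0 < ε) : ∃ r > x, ν.real (Set.Iio r) ≤ ν.real (Set.Iic x) + ε := by
  have hanti : Antitone fun k : ℕ => Set.Iio (x + 1 / ((k : ℝ) + 1)) := fun k m hkm =>
    Set.Iio_subset_Iio (by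
      have : 1 / ((m : ℝ) + 1) ≤ 1 / ((k : ℝ) + 1) := Nat.one_div_le_one_div hkm
      linarith)
  have hU : ⋂ k : ℕ, Set.Iio (x + 1 / ((k : ℝ) + 1)) = Set.Iic x := by
    ext y
    simp only [Set.mem_iInter, Set.mem_Iic, Set.mem_Iio]
    refine ⟨fun h => ?_, fun hy k => ?_⟩
    · by_contra! hy
      obtain ⟨k, hk⟩ := exists_nat_one_div_lt (sub_pos.2 hy)
      linarith [h k]
    · have : 0 < 1 / ((k : ℝ) + 1) := Nat.one_div_pos_of_nat
      linarith
  have h := tendsto_measure_iInter_atTop (μ := ν) (fun k => measurableSet_Iio.nullMeasurableSet)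
    hanti ⟨0, measure_ne_top _ _⟩
  rw [hU] at h
  have h' := (ENNReal.tendsto_toReal (measure_ne_top ν (Set.Iic x))).comp h
  obtain ⟨k, hk⟩ := (h'.eventually_lt_const
    (show ν.real (Set.Iic x) < ν.real (Set.Iic x) + ε by linarith)).exists
  refine ⟨x + 1 / ((k : ℝ) + 1), ?_, ?_⟩
  · have : 0 < 1 / ((k : ℝ) + 1) := Nat.one_div_pos_of_nat
    linarith
  · exact le_of_lt hk

lemma abs_half_add_sub_le {A B A' B' p q p' q' ε δ : ℝ} (h1 : p ≤ A) (h2 : A ≤ B) (h3 : B ≤ q)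
    (h1' : p' ≤ A') (h2' : A' ≤ B') (h3' : B' ≤ q') (hp : |p - p'| ≤ δ) (hq : |q - q'| ≤ δ)
    (h : q' ≤ p' + ε) : |(A + B) / 2 - (A' + B') / 2| ≤ ε + δ := by
  rw [abs_le] at *
  constructor <;> linarith [hp.1, hp.2, hq.1, hq.2]

/-- Finitely many points control the uniform distance of a normalized distribution function to
that of `ν`. -/
lemma exists_finset_bracket (ν : Measure ℝ) [IsProbabilityMeasure ν] {ε : ℝ} (hε : 0 < ε) :
    ∃ T : Finset ℝ, ∀ A B : ℝ → ℝ, (∀ t, 0 ≤ A t) → (∀ t, A t ≤ B t) → (∀ t, B t ≤ 1) →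
      (∀ s t, s < t → B s ≤ A t) → ∀ δ : ℝ, 0 ≤ δ →
      (∀ t ∈ T, |A t - ν.real (Set.Iio t)| ≤ δ ∧ |B t - ν.real (Set.Iic t)| ≤ δ) →
      ∀ y, |(A y + B y) / 2 - (ν.real (Set.Iio y) + ν.real (Set.Iic y)) / 2| ≤ ε + δ := by
  classical
  choose l hl hl' using fun x => exists_lt_measureReal_Iio_le ν x hε
  choose r hr hr' using fun x => exists_gt_measureReal_Iio_le ν x hε
  have hbot : Tendsto (fun p => ν.real (Set.Iic p)) atBot (𝓝 0) := by
    exact (tendsto_cdf_atBot ν).congr (cdf_eq_real ν)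
  have htop : Tendsto (fun p => ν.real (Set.Iic p)) atTop (𝓝 1) := by
    exact (tendsto_cdf_atTop ν).congr (cdf_eq_real ν)
  obtain ⟨p, hp⟩ := (hbot.eventually_lt_const hε).exists
  obtain ⟨q, hq⟩ := (htop.eventually_const_lt (show 1 - ε < 1 by linarith)).exists
  have hle t : ν.real (Set.Iio t) ≤ ν.real (Set.Iic t) := measureReal_mono Set.Iio_subset_Iic_self
  have hlt s t (h : s < t) : ν.real (Set.Iic s) ≤ ν.real (Set.Iio t) :=
    measureReal_mono (Set.Iic_subset_Iio.2 h)
  -- Outside `[p, q]` the tails are below `ε`; inside, compactness leaves finitely many such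
  -- neighbourhoods. Their centres also belong to the test set, so atoms there are compared directly
  -- and not bracketed.
  obtain ⟨S, -, hS⟩ := (isCompact_Icc (a := p) (b := q)).elim_nhds_subcover
    (fun x => Set.Ioo (l x) (r x)) fun x _ => Ioo_mem_nhds (hl x) (hr x)
  refine ⟨{p, q} ∪ (S ∪ (S.image l ∪ S.image r)), fun A B hA hAB hB hBA δ hδ hT y => ?_⟩
  have hTS x (hx : x ∈ S) := hT x (by simp [hx])
  have hTl x (hx : x ∈ S) := hT (l x) (by
    simp only [Finset.mem_union]; exact .inr (.inr (.inl (Finset.mem_image_of_mem _ hx))))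
  have hTr x (hx : x ∈ S) := hT (r x) (by
    simp only [Finset.mem_union]; exact .inr (.inr (.inr (Finset.mem_image_of_mem _ hx))))
  have hTp := hT p (by simp)
  have hTq := hT q (by simp)
  rcases lt_or_ge y p with hy | hy
  · exact abs_half_add_sub_le (hA y) (hAB y) (hBA y p hy) measureReal_nonneg (hle y) (hlt y p hy)
      (by simpa using hδ) hTp.1 (by linarith [hle p])
  rcases lt_or_ge q y with hy' | hy'
  · exact abs_half_add_sub_le (hBA q y hy') (hAB y) (hB y) (hlt q y hy') (hle y)
      measureReal_le_one hTq.2 (by simpa using hδ) (by linarith)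
  obtain ⟨x, hx, hyx⟩ := Set.mem_iUnion₂.1 (hS ⟨hy, hy'⟩)
  rcases lt_trichotomy y x with h | h | h
  · exact abs_half_add_sub_le (hBA _ _ hyx.1) (hAB y) (hBA _ _ h) (hlt _ _ hyx.1) (hle y)
      (hlt _ _ h) (hTl x hx).2 (hTS x hx).1 (hl' x)
  · subst h
    obtain ⟨h1, h2⟩ := hTS y hx
    rw [abs_le] at *
    constructor <;> linarith [h1.1, h1.2, h2.1, h2.2]
  · exact abs_half_add_sub_le (hBA _ _ h) (hAB y) (hBA _ _ hyx.2) (hlt _ _ h) (hle y)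
      (hlt _ _ hyx.2) (hTS x hx).2 (hTr x hx).1 (hr' x)

variable {Ω : Type*} [MeasurableSpace Ω] {P : Measure Ω} [IsProbabilityMeasure P]

lemma tendsto_mean_of_bounded {E : Type*} [MeasurableSpace E] {Y : ℕ → Ω → E}
    (hmeas : ∀ k, Measurable (Y k)) (hindep : iIndepFun Y P) {ρ : Measure E}
    (hlaw : ∀ k, P.map (Y k) = ρ) {f : E → ℝ} (hf : Measurable f) {C : ℝ} (hC : ∀ y, |f y| ≤ C) :
    ∀ᵐ ω ∂P, Tendsto (fun k : ℕ => (k : ℝ)⁻¹ * ∑ u ∈ Finset.range k, f (Y u ω)) atTop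
      (𝓝 (∫ y, f y ∂ρ)) := by
  have h := strong_law_ae_real (μ := P) (fun k ω => f (Y k ω))
    (.of_bound (hf.comp (hmeas 0)).aestronglyMeasurable C (.of_forall fun ω => hC _))
    (fun k m hkm => (hindep.indepFun hkm).comp hf hf)
    (fun k => ((⟨(hmeas k).aemeasurable, (hmeas 0).aemeasurable, by rw [hlaw, hlaw]⟩ :
      IdentDistrib (Y k) (Y 0) P P)).comp hf)
  filter_upwards [h] with ω hω
  rw [← hlaw 0, integral_map (hmeas 0).aemeasurable hf.aestronglyMeasurable]
  exact hω.congr fun k => by rw [div_eq_inv_mul]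

lemma countFun_eq (t x : ℝ) :
    countFun (t - x) = ((Set.Iio t).indicator 1 x + (Set.Iic t).indicator 1 x) / 2 := by
  unfold countFun
  rcases lt_trichotomy x t with h | h | h
  · have h1 : t - x ≠ 0 := by linarith
    simp [h, h.le, h1]
  · simp [h]
  · have h1 : t - x ≠ 0 := by linarith
    simp [h.not_ge, h.le.not_gt, h1]

/-- The Glivenko-Cantelli theorem for normalized distribution functions. -/
lemma glivenko_cantelli {Y : ℕ → Ω → ℝ} (hmeas : ∀ k, Measurable (Y k)) (hindep : iIndepFun Y P)
    {ν : Measure ℝ} [IsProbabilityMeasure ν] (hlaw : ∀ k, P.map (Y k) = ν) :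
    ∀ᵐ ω ∂P, ∀ ε > 0, ∀ᶠ k : ℕ in atTop, ∀ t,
      |(k : ℝ)⁻¹ * ∑ u ∈ Finset.range k, countFun (t - Y u ω)
        - (ν.real (Set.Iio t) + ν.real (Set.Iic t)) / 2| ≤ ε := by
  -- Only the accuracies `1 / (m + 1)` are used, so countably many laws of large numbers, hence one
  -- null set, suffice.
  choose T hT using fun m : ℕ => exists_finset_bracket ν (Nat.one_div_pos_of_nat (α := ℝ) (n := m))
  have hind (S : Set ℝ) (hS : MeasurableSet S) : ∀ᵐ ω ∂P, Tendsto
      (fun k : ℕ => (k : ℝ)⁻¹ * ∑ u ∈ Finset.range k, S.indicator (1 : ℝ → ℝ) (Y u ω)) atTop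
      (𝓝 (ν.real S)) := by
    have := tendsto_mean_of_bounded hmeas hindep hlaw (f := S.indicator 1)
      (measurable_one.indicator hS) (C := 1) fun y => by
        by_cases hy : y ∈ S <;> simp [hy]
    rwa [integral_indicator_one hS] at this
  have hall : ∀ᵐ ω ∂P, ∀ m : ℕ, ∀ t ∈ T m,
      Tendsto (fun k : ℕ => (k : ℝ)⁻¹ * ∑ u ∈ Finset.range k,
        (Set.Iio t).indicator (1 : ℝ → ℝ) (Y u ω)) atTop (𝓝 (ν.real (Set.Iio t))) ∧
      Tendsto (fun k : ℕ => (k : ℝ)⁻¹ * ∑ u ∈ Finset.range k,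
        (Set.Iic t).indicator (1 : ℝ → ℝ) (Y u ω)) atTop (𝓝 (ν.real (Set.Iic t))) := by
    refine ae_all_iff.2 fun m => (Finset.eventually_all _).2 fun t _ => ?_
    filter_upwards [hind _ measurableSet_Iio, hind _ measurableSet_Iic] with ω h1 h2
    exact ⟨h1, h2⟩
  filter_upwards [hall] with ω hω ε hε
  obtain ⟨m, hm⟩ := exists_nat_one_div_lt (half_pos hε)
  have hclose {φ : ℕ → ℝ} {L : ℝ} (h : Tendsto φ atTop (𝓝 L)) :
      ∀ᶠ k in atTop, |φ k - L| ≤ ε / 2 := by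
    filter_upwards [h.eventually (Metric.closedBall_mem_nhds L (half_pos hε))] with k hk
    simpa [Real.dist_eq] using hk
  have hev := (Finset.eventually_all (T m)).2 fun t ht =>
    (hclose (hω m t ht).1).and (hclose (hω m t ht).2)
  filter_upwards [hev] with k hk t
  have hle (S : Set ℝ) (x : ℝ) : S.indicator (1 : ℝ → ℝ) x ≤ 1 :=
    Set.indicator_le_self' (by simp) x
  have key := hT m (fun t => (k : ℝ)⁻¹ * ∑ u ∈ Finset.range k,
        (Set.Iio t).indicator (1 : ℝ → ℝ) (Y u ω)) (fun t => (k : ℝ)⁻¹ * ∑ u ∈ Finset.range k,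
        (Set.Iic t).indicator (1 : ℝ → ℝ) (Y u ω))
    (fun t => mul_nonneg (by positivity) (Finset.sum_nonneg fun u _ =>
      Set.indicator_nonneg (by simp) _))
    (fun t => mul_le_mul_of_nonneg_left (Finset.sum_le_sum fun u _ =>
      Set.indicator_le_indicator_of_subset Set.Iio_subset_Iic_self (by simp) _) (by positivity))
    (fun t => by
      have : ∑ u ∈ Finset.range k, (Set.Iic t).indicator (1 : ℝ → ℝ) (Y u ω) ≤ k := by
        simpa using Finset.sum_le_sum fun (u : ℕ) (_ : u ∈ Finset.range k) =>
          hle (Set.Iic t) (Y u ω)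
      rw [inv_mul_eq_div]
      exact div_le_one_of_le₀ this (by positivity))
    (fun s t hst => mul_le_mul_of_nonneg_left (Finset.sum_le_sum fun u _ =>
      Set.indicator_le_indicator_of_subset (Set.Iic_subset_Iio.2 hst) (by simp) _)
        (by positivity))
    (ε / 2) (half_pos hε).le hk t
  simp_rw [countFun_eq, ← Finset.sum_div, Finset.sum_add_distrib]
  rw [← mul_div_assoc, mul_add]
  linarith

end GlivenkoCantelli

/-! ### The limit covariance as a sum over groups -/

section LimitCovariance

lemma abs_projFun_le {a d : ℕ} {F : Fin a → Fin d → ℝ → ℝ} (hF : ∀ i j t, |F i j t| ≤ 1)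
    (g : Fin a) (s : Fin a × Fin d) (y : Fin d → ℝ) : |projFun F g s y| ≤ 2 := by
  unfold projFun
  have h1 (p : Prop) [Decidable p] (t : ℝ) (ht : |t| ≤ 1) : |if p then t else 0| ≤ 1 := by
    split_ifs <;> simp [ht]
  have h2 : |∑ l : Fin a, ((if g = s.1 then F l s.2 (y s.2) else 0)
      - (if g = l then F s.1 s.2 (y s.2) else 0))| ≤ a * 2 := by
    have h3 : ∀ l ∈ (Finset.univ : Finset (Fin a)), |(if g = s.1 then F l s.2 (y s.2) else 0)
        - (if g = l then F s.1 s.2 (y s.2) else 0)| ≤ 2 := fun l _ => by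
      have h4 := h1 (g = s.1) _ (hF l s.2 (y s.2))
      have h5 := h1 (g = l) _ (hF s.1 s.2 (y s.2))
      exact (abs_sub _ _).trans (by linarith)
    refine (Finset.abs_sum_le_sum_abs _ _).trans ((Finset.sum_le_sum h3).trans ?_)
    simp
  have ha : (0 : ℝ) < a := Nat.cast_pos.2 (Fin.pos g)
  rw [abs_mul, abs_of_nonneg (by positivity), one_div, inv_mul_le_iff₀ ha]
  exact h2

lemma measurable_projFun {a d : ℕ} {F : Fin a → Fin d → ℝ → ℝ} (hF : ∀ i j, Measurable (F i j))
    (g : Fin a) (s : Fin a × Fin d) : Measurable (projFun F g s) := by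
  have h (i : Fin a) (j : Fin d) : Measurable fun y : Fin d → ℝ => F i j (y j) :=
    (hF i j).comp (measurable_pi_apply j)
  unfold projFun
  refine (Finset.measurable_fun_sum _ fun l _ => ?_).const_mul _
  split_ifs <;> fun_prop

variable {a d : ℕ} (Q : Fin a → Measure (Fin d → ℝ)) [∀ i, IsProbabilityMeasure (Q i)]

omit [∀ i, IsProbabilityMeasure (Q i)] in
lemma normCDF_eq_map (i : Fin a) (j : Fin d) (t : ℝ) :
    normCDF Q i j t = (((Q i).map fun y => y j).real (Set.Iio t)
      + ((Q i).map fun y => y j).real (Set.Iic t)) / 2 := by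
  unfold normCDF
  rw [map_measureReal_apply (measurable_pi_apply j) measurableSet_Iio,
    map_measureReal_apply (measurable_pi_apply j) measurableSet_Iic]
  rfl

lemma abs_normCDF_le (i : Fin a) (j : Fin d) (t : ℝ) : |normCDF Q i j t| ≤ 1 := by
  unfold normCDF
  have h1 : (Q i).real {y | y j < t} ≤ 1 := measureReal_le_one
  have h2 : (Q i).real {y | y j ≤ t} ≤ 1 := measureReal_le_one
  rw [abs_of_nonneg (by positivity)]
  linarith

lemma measurable_normCDF (i : Fin a) (j : Fin d) : Measurable (normCDF Q i j) := by
  refine Monotone.measurable fun s t hst => ?_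
  unfold normCDF
  have h1 : (Q i).real {y | y j < s} ≤ (Q i).real {y | y j < t} :=
    measureReal_mono fun y (hy : y j < s) => lt_of_lt_of_le hy hst
  have h2 : (Q i).real {y | y j ≤ s} ≤ (Q i).real {y | y j ≤ t} :=
    measureReal_mono fun y (hy : y j ≤ s) => le_trans hy hst
  linarith

lemma memLp_normCDF (g i : Fin a) (j : Fin d) :
    MemLp (fun y : Fin d → ℝ => normCDF Q i j (y j)) 2 (Q g) :=
  .of_bound ((measurable_normCDF Q i j).comp (measurable_pi_apply j)).aestronglyMeasurable 1
    (.of_forall fun _ => abs_normCDF_le Q i j _)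

lemma memLp_projFun (g : Fin a) (s : Fin a × Fin d) :
    MemLp (projFun (normCDF Q) g s) 2 (Q g) :=
  .of_bound (measurable_projFun (measurable_normCDF Q) g s).aestronglyMeasurable 2
    (.of_forall fun _ => abs_projFun_le (abs_normCDF_le Q) g s _)

omit [∀ i, IsProbabilityMeasure (Q i)] in
lemma covariance_ite_sub_ite {E : Type*} [MeasurableSpace E] (ρ : Measure E)
    [IsProbabilityMeasure ρ] {A B A' B' : E → ℝ} (hA : MemLp A 2 ρ) (hB : MemLp B 2 ρ)
    (hA' : MemLp A' 2 ρ) (hB' : MemLp B' 2 ρ) (p q p' q' : Prop) [Decidable p] [Decidable q]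
    [Decidable p'] [Decidable q'] :
    cov[fun y => (if p then A y else 0) - (if q then B y else 0),
      fun y => (if p' then A' y else 0) - (if q' then B' y else 0); ρ] =
    (if p then if p' then cov[A, A'; ρ] else 0 else 0)
      - (if p then if q' then cov[A, B'; ρ] else 0 else 0)
      - (if q then if p' then cov[B, A'; ρ] else 0 else 0)
      + (if q then if q' then cov[B, B'; ρ] else 0 else 0) := by
  have hm {A : E → ℝ} (hA : MemLp A 2 ρ) (p : Prop) [Decidable p] :
      MemLp (fun y => if p then A y else 0) 2 ρ := by
    split_ifs
    · exact hA
    · exact memLp_const 0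
  have hc {A B : E → ℝ} (p q : Prop) [Decidable p] [Decidable q] :
      cov[fun y => if p then A y else 0, fun y => if q then B y else 0; ρ] =
        if p then if q then cov[A, B; ρ] else 0 else 0 := by
    split_ifs <;> simp
  rw [covariance_fun_sub_fun_sub (hm hA p) (hm hB q) (hm hA' p') (hm hB' q'), hc, hc, hc, hc]

/-- Each `projFun` is a difference of two terms, one active for `g = i` and one for `g = l`.
Bilinearity yields four covariances, and summing their indicators over `g` produces the four
Kronecker deltas of `pairCov`. -/
lemma limitCov_apply (lam : Fin a → ℝ) (s s' : Fin a × Fin d) :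
    limitCov Q lam s s' = ∑ g, (1 / lam g) *
      cov[projFun (normCDF Q) g s, projFun (normCDF Q) g s'; Q g] := by
  have h (g : Fin a) : cov[projFun (normCDF Q) g s, projFun (normCDF Q) g s'; Q g] =
      (1 / (a : ℝ) ^ 2) * ∑ l, ∑ l',
        ((if g = s.1 then if g = s'.1 then groupCov Q g l s.2 l' s'.2 else 0 else 0)
          - (if g = s.1 then if g = l' then groupCov Q g l s.2 s'.1 s'.2 else 0 else 0)
          - (if g = l then if g = s'.1 then groupCov Q g s.1 s.2 l' s'.2 else 0 else 0)
          + (if g = l then if g = l' then groupCov Q g s.1 s.2 s'.1 s'.2 else 0 else 0)) := by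
    have hm (s : Fin a × Fin d) (l : Fin a) : MemLp (fun y : Fin d → ℝ =>
        (if g = s.1 then normCDF Q l s.2 (y s.2) else 0)
          - (if g = l then normCDF Q s.1 s.2 (y s.2) else 0)) 2 (Q g) := by
      refine MemLp.sub (f := fun y : Fin d → ℝ => if g = s.1 then normCDF Q l s.2 (y s.2) else 0)
        (g := fun y : Fin d → ℝ => if g = l then normCDF Q s.1 s.2 (y s.2) else 0) ?_ ?_
      · split_ifs
        · exact memLp_normCDF Q _ _ _
        · exact memLp_const 0
      · split_ifs
        · exact memLp_normCDF Q _ _ _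
        · exact memLp_const 0
    unfold projFun
    rw [covariance_const_mul_left, covariance_const_mul_right,
      covariance_fun_sum_fun_sum (hm s) (hm s'), ← mul_assoc, one_div_mul_one_div, ← sq]
    congr 1
    refine Finset.sum_congr rfl fun l _ => Finset.sum_congr rfl fun l' _ => ?_
    rw [covariance_ite_sub_ite (Q g) (memLp_normCDF Q g _ _) (memLp_normCDF Q g _ _)
      (memLp_normCDF Q g _ _) (memLp_normCDF Q g _ _)]
    rfl
  unfold limitCov
  simp_rw [h, Matrix.of_apply, mul_left_comm _ (1 / (a : ℝ) ^ 2), ← Finset.mul_sum]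
  congr 1
  simp_rw [Finset.mul_sum]
  conv_rhs => rw [Finset.sum_comm]
  refine Finset.sum_congr rfl fun l _ => ?_
  conv_rhs => rw [Finset.sum_comm]
  refine Finset.sum_congr rfl fun l' _ => ?_
  unfold pairCov
  simp_rw [mul_add, mul_sub, mul_ite, mul_zero, Finset.sum_add_distrib, Finset.sum_sub_distrib]
  simp only [Finset.sum_ite_eq', Finset.mem_univ, if_true]
  ring

/-- The quadratic form of the limit covariance matrix. -/
lemma dotProduct_limitCov_mulVec (lam : Fin a → ℝ) (t : Fin a × Fin d → ℝ) :
    t ⬝ᵥ (limitCov Q lam).mulVec t =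
      ∑ g, (1 / lam g) * Var[fun y => ∑ s, t s * projFun (normCDF Q) g s y; Q g] := by
  have hv (g : Fin a) : Var[fun y => ∑ s, t s * projFun (normCDF Q) g s y; Q g] =
      ∑ s, ∑ s', t s * t s' * cov[projFun (normCDF Q) g s, projFun (normCDF Q) g s'; Q g] := by
    have hm (s : Fin a × Fin d) : MemLp (fun y => t s * projFun (normCDF Q) g s y) 2 (Q g) :=
      (memLp_projFun Q g s).const_mul _
    rw [← covariance_self (Finset.aemeasurable_fun_sum _ fun s _ => (hm s).aemeasurable),
      covariance_fun_sum_fun_sum hm hm]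
    simp_rw [covariance_const_mul_left, covariance_const_mul_right, mul_assoc]
  simp_rw [hv, dotProduct, Matrix.mulVec, dotProduct, limitCov_apply, Finset.mul_sum,
    Finset.sum_mul, Finset.mul_sum]
  conv_rhs => rw [Finset.sum_comm]
  rw [Finset.sum_comm]
  refine Finset.sum_congr rfl fun s _ => ?_
  conv_rhs => rw [Finset.sum_comm]
  exact Finset.sum_congr rfl fun s' _ => Finset.sum_congr rfl fun g _ => by
    rw [covariance_comm]; ring

lemma posSemidef_limitCov {lam : Fin a → ℝ} (hlam : ∀ i, 0 ≤ lam i) :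
    (limitCov Q lam).PosSemidef := by
  refine Matrix.PosSemidef.of_dotProduct_mulVec_nonneg ?_ fun t => ?_
  · ext s s'
    simp only [Matrix.conjTranspose_apply, star_trivial, limitCov_apply]
    simp_rw [covariance_comm (projFun (normCDF Q) _ s)]
  · rw [star_trivial, dotProduct_limitCov_mulVec]
    exact Finset.sum_nonneg fun g _ =>
      mul_nonneg (one_div_nonneg.2 (hlam g)) (variance_nonneg _ _)

end LimitCovariance

/-! ### Convergence along a fixed realization of the data -/

section Convergence

lemma dist_euclideanSpace_le_sum {ι : Type*} [Fintype ι] (x y : EuclideanSpace ℝ ι) :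
    dist x y ≤ ∑ s, |x s - y s| := by
  rw [EuclideanSpace.dist_eq]
  refine Real.sqrt_le_iff.2 ⟨Finset.sum_nonneg fun _ _ => abs_nonneg _, ?_⟩
  simp_rw [Real.dist_eq]
  exact Finset.sum_sq_le_sq_sum_of_nonneg fun _ _ => abs_nonneg _

variable {a d : ℕ}

section SampleSizes

variable {n : ℕ → Fin a → ℕ} {lam : Fin a → ℝ}

lemma tendsto_size_atTop (hN : Tendsto (fun m => ∑ i, n m i) atTop atTop)
    (hlam : ∀ i, 0 < lam i)
    (hn : ∀ i, Tendsto (fun m => (n m i : ℝ) / ((∑ l, n m l : ℕ) : ℝ)) atTop (𝓝 (lam i)))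
    (i : Fin a) : Tendsto (fun m => n m i) atTop atTop := by
  have hN' : Tendsto (fun m => ((∑ l, n m l : ℕ) : ℝ)) atTop atTop :=
    tendsto_natCast_atTop_atTop.comp hN
  have h := (hn i).pos_mul_atTop (hlam i) hN'
  refine tendsto_natCast_atTop_iff (R := ℝ).1 (h.congr' ?_)
  filter_upwards [hN.eventually_ne_atTop 0] with m hm
  exact div_mul_cancel₀ _ (Nat.cast_ne_zero.2 hm)

variable [∀ m i, NeZero (n m i)]

omit [∀ m i, NeZero (n m i)] in
lemma tendsto_sqrt_div_sqrt
    (hlam : ∀ i, 0 < lam i)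
    (hn : ∀ i, Tendsto (fun m => (n m i : ℝ) / ((∑ l, n m l : ℕ) : ℝ)) atTop (𝓝 (lam i)))
    (i : Fin a) : Tendsto (fun m => √((∑ l, n m l : ℕ) : ℝ) / √(n m i)) atTop
      (𝓝 (√(lam i)⁻¹)) := by
  refine ((hn i).inv₀ (hlam i).ne').sqrt.congr fun m => ?_
  rw [inv_div, Real.sqrt_div (by positivity)]

omit [∀ m i, NeZero (n m i)] in
lemma tendsto_sqrt_mul_linearization_bound
    (hN : Tendsto (fun m => ∑ i, n m i) atTop atTop) (hlam : ∀ i, 0 < lam i)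
    (hn : ∀ i, Tendsto (fun m => (n m i : ℝ) / ((∑ l, n m l : ℕ) : ℝ)) atTop (𝓝 (lam i)))
    (ε : ℝ) : Tendsto (fun m => ∑ s : Fin a × Fin d, √((∑ l, n m l : ℕ) : ℝ) *
      ((1 / (a : ℝ)) * ∑ l,
        (4 / √((n m l : ℝ) * n m s.1) + 2 * ε / √(n m s.1) + 2 * ε / √(n m l)))) atTop
      (𝓝 (ε * ∑ s : Fin a × Fin d, (1 / (a : ℝ)) * ∑ l,
        (2 * √(lam s.1)⁻¹ + 2 * √(lam l)⁻¹))) := by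
  have hq := tendsto_sqrt_div_sqrt hlam hn
  have h0 (i : Fin a) : Tendsto (fun m => (√(n m i : ℝ))⁻¹) atTop (𝓝 0) :=
    tendsto_inv_atTop_zero.comp (Real.tendsto_sqrt_atTop.comp
      (tendsto_natCast_atTop_atTop.comp (tendsto_size_atTop hN hlam hn i)))
  -- The degenerate term contains `√N / √(n_l n_i)`, which tends to `0`; in the other terms `√N /
  -- √n` converges, leaving a limit proportional to `ε`.
  have h (s : Fin a × Fin d) := (tendsto_finsetSum Finset.univ fun l _ =>
    ((((hq l).mul (h0 s.1)).const_mul 4).add ((hq s.1).const_mul (2 * ε))).add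
      ((hq l).const_mul (2 * ε))).const_mul (1 / (a : ℝ))
  have h' := tendsto_finsetSum Finset.univ fun s _ => h s
  convert h' using 2
  · refine Finset.sum_congr rfl fun s _ => ?_
    rw [mul_left_comm]
    congr 1
    rw [Finset.mul_sum]
    refine Finset.sum_congr rfl fun l _ => ?_
    rw [Real.sqrt_mul (by positivity)]
    field_simp
  · rw [Finset.mul_sum]
    refine Finset.sum_congr rfl fun s _ => ?_
    rw [mul_left_comm, Finset.mul_sum]
    congr 1
    exact Finset.sum_congr rfl fun l _ => by ring

end SampleSizes

lemma inv_mul_sum_sub_mean_sq {k : ℕ} [NeZero k] (f : Fin k → ℝ) :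
    (k : ℝ)⁻¹ * ∑ u, (f u - 1 / (k : ℝ) * ∑ v, f v) ^ 2 =
      (k : ℝ)⁻¹ * ∑ u, f u ^ 2 - ((k : ℝ)⁻¹ * ∑ u, f u) ^ 2 := by
  have hk : (k : ℝ) ≠ 0 := Nat.cast_ne_zero.2 (NeZero.ne k)
  simp only [sub_sq, Finset.sum_add_distrib, Finset.sum_sub_distrib, ← Finset.sum_mul,
    ← Finset.mul_sum, Finset.sum_const, Finset.card_univ, Fintype.card_fin, nsmul_eq_mul]
  field_simp
  ring

variable {Q : Fin a → Measure (Fin d → ℝ)} [∀ i, IsProbabilityMeasure (Q i)]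
  {n : ℕ → Fin a → ℕ} {lam : Fin a → ℝ} {Z : Fin a → ℕ → Fin d → ℝ}

/-- Expanding the square reduces all `t` to finitely many means and products that do not involve
`t`, so the exceptional null set does not depend on `t`. -/
lemma tendsto_empirical_variance
    (hmean : ∀ g s, Tendsto (fun k : ℕ => (k : ℝ)⁻¹ *
      ∑ u ∈ Finset.range k, projFun (normCDF Q) g s (Z g u)) atTop
      (𝓝 (∫ y, projFun (normCDF Q) g s y ∂(Q g))))
    (hprod : ∀ g s s', Tendsto (fun k : ℕ => (k : ℝ)⁻¹ *
      ∑ u ∈ Finset.range k, projFun (normCDF Q) g s (Z g u) * projFun (normCDF Q) g s' (Z g u))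
      atTop (𝓝 (∫ y, projFun (normCDF Q) g s y * projFun (normCDF Q) g s' y ∂(Q g))))
    (t : Fin a × Fin d → ℝ) (g : Fin a) :
    Tendsto (fun k : ℕ => (k : ℝ)⁻¹ *
      ∑ u ∈ Finset.range k, (∑ s, t s * projFun (normCDF Q) g s (Z g u)) ^ 2
      - ((k : ℝ)⁻¹ * ∑ u ∈ Finset.range k, ∑ s, t s * projFun (normCDF Q) g s (Z g u)) ^ 2) atTop
      (𝓝 (Var[fun y => ∑ s, t s * projFun (normCDF Q) g s y; Q g])) := by
  have hm := memLp_projFun Q g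
  have hi s s' : Integrable (fun y => projFun (normCDF Q) g s y * projFun (normCDF Q) g s' y)
    (Q g) := (hm s).integrable_mul (hm s')
  have e1 : ∫ y, (∑ s, t s * projFun (normCDF Q) g s y) ∂(Q g) =
      ∑ s, t s * ∫ y, projFun (normCDF Q) g s y ∂(Q g) := by
    rw [integral_finsetSum _ fun s _ => ((hm s).integrable one_le_two).const_mul _]
    simp_rw [integral_const_mul]
  have e2 : ∫ y, (∑ s, t s * projFun (normCDF Q) g s y) ^ 2 ∂(Q g) =
      ∑ s, ∑ s', t s * t s' * ∫ y, projFun (normCDF Q) g s y * projFun (normCDF Q) g s' y ∂(Q g) := by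
    simp_rw [sq, Finset.sum_mul_sum, mul_mul_mul_comm (t _)]
    rw [integral_finsetSum _ fun s _ => integrable_finsetSum _ fun s' _ => (hi s s').const_mul _]
    simp_rw [integral_finsetSum _ fun s' _ => (hi _ s').const_mul _, integral_const_mul]
  rw [variance_eq_sub (memLp_finsetSum _ fun s _ => (hm s).const_mul _)]
  simp only [Pi.pow_apply]
  rw [e1, e2]
  refine Tendsto.sub ?_ (Tendsto.pow ?_ 2)
  · refine (tendsto_finsetSum Finset.univ fun s _ => tendsto_finsetSum Finset.univ fun s' _ =>
      (hprod g s s').const_mul (t s * t s')).congr fun k => ?_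
    simp_rw [sq, Finset.sum_mul_sum, mul_mul_mul_comm (t _)]
    conv_rhs => rw [Finset.sum_comm, Finset.mul_sum]
    refine Finset.sum_congr rfl fun s _ => ?_
    conv_rhs => rw [Finset.sum_comm, Finset.mul_sum]
    refine Finset.sum_congr rfl fun s' _ => ?_
    rw [← Finset.mul_sum, mul_left_comm]
  · refine (tendsto_finsetSum Finset.univ fun s _ => (hmean g s).const_mul (t s)).congr fun k => ?_
    conv_rhs => rw [Finset.sum_comm, Finset.mul_sum]
    refine Finset.sum_congr rfl fun s _ => ?_
    rw [← Finset.mul_sum, mul_left_comm]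

variable [∀ m i, NeZero (n m i)]

lemma tendsto_charFun_linStat (hN : Tendsto (fun m => ∑ i, n m i) atTop atTop)
    (hlam : ∀ i, 0 < lam i)
    (hn : ∀ i, Tendsto (fun m => (n m i : ℝ) / ((∑ l, n m l : ℕ) : ℝ)) atTop (𝓝 (lam i)))
    (hmean : ∀ g s, Tendsto (fun k : ℕ => (k : ℝ)⁻¹ *
      ∑ u ∈ Finset.range k, projFun (normCDF Q) g s (Z g u)) atTop
      (𝓝 (∫ y, projFun (normCDF Q) g s y ∂(Q g))))
    (hprod : ∀ g s s', Tendsto (fun k : ℕ => (k : ℝ)⁻¹ *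
      ∑ u ∈ Finset.range k, projFun (normCDF Q) g s (Z g u) * projFun (normCDF Q) g s' (Z g u))
      atTop (𝓝 (∫ y, projFun (normCDF Q) g s y * projFun (normCDF Q) g s' y ∂(Q g))))
    (t : EuclideanSpace ℝ (Fin a × Fin d)) :
    Tendsto (fun m => charFun ((indexLaw (n m)).map
      (linStat (fun i (k : Fin (n m i)) => Z i k) (normCDF Q))) t) atTop
      (𝓝 (charFun (multivariateGaussian 0 (limitCov Q lam)) t)) := by
  simp_rw [charFun_linStat]
  rw [charFun_multivariateGaussian (posSemidef_limitCov Q fun i => (hlam i).le)]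
  have hexp : Complex.exp ((inner ℝ t (0 : EuclideanSpace ℝ (Fin a × Fin d)) : ℝ) * Complex.I
      - ((t.ofLp ⬝ᵥ (limitCov Q lam).mulVec t.ofLp : ℝ) : ℂ) / 2) =
      ∏ g, Complex.exp (-(((lam g)⁻¹ *
        Var[fun y => ∑ s, t s * projFun (normCDF Q) g s y; Q g] / 2 : ℝ) : ℂ)) := by
    rw [← Complex.exp_sum, dotProduct_limitCov_mulVec]
    congr 1
    simp [Finset.sum_div]
  rw [hexp]
  refine tendsto_finsetProd _ fun g _ => ?_
  have hsize := tendsto_size_atTop hN hlam hn g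
  set φ : (Fin d → ℝ) → ℝ := fun y => ∑ s, t s * projFun (normCDF Q) g s y with hφ
  have hφC y : |φ y| ≤ ∑ s, |t s| * 2 := by
    refine (Finset.abs_sum_le_sum_abs _ _).trans (Finset.sum_le_sum fun s _ => ?_)
    rw [abs_mul]
    exact mul_le_mul_of_nonneg_left (abs_projFun_le (abs_normCDF_le Q) g s y) (abs_nonneg _)
  have hpos m : (0 : ℝ) < n m g := Nat.cast_pos.2 (NeZero.pos _)
  -- Here `θ = √N / n_g`, so `n_g θ² = N / n_g` tends to `1 / lam g`, the weight of the group
  -- variance.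
  refine tendsto_mean_exp_pow (k := fun m => n m g) hsize
    (fun m u => φ (Z g u) - 1 / (n m g : ℝ) * ∑ v : Fin (n m g), φ (Z g v))
    (fun m => √((∑ i, n m i : ℕ) : ℝ) / n m g) (C := 2 * ∑ s, |t s| * 2) ?_ ?_ ?_ ?_
  · intro m u
    have h1 : |1 / (n m g : ℝ) * ∑ v : Fin (n m g), φ (Z g v)| ≤ ∑ s, |t s| * 2 := by
      rw [abs_mul, abs_of_nonneg (by positivity), one_div, inv_mul_le_iff₀ (hpos m)]
      refine (Finset.abs_sum_le_sum_abs _ _).trans ?_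
      simpa using Finset.sum_le_sum fun (v : Fin (n m g)) (_ : v ∈ Finset.univ) => hφC (Z g v)
    exact (abs_sub _ _).trans (by linarith [hφC (Z g u)])
  · intro m
    have := (hpos m).ne'
    simp only [Finset.sum_sub_distrib, Finset.sum_const, Finset.card_univ, Fintype.card_fin,
      nsmul_eq_mul]
    field_simp
    ring
  · refine ((hn g).inv₀ (hlam g).ne').congr fun m => ?_
    have := (hpos m).ne'
    rw [div_pow, Real.sq_sqrt (by positivity)]
    field_simp
  · refine ((tendsto_empirical_variance hmean hprod t g).comp hsize).congr fun m => ?_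
    rw [inv_mul_sum_sub_mean_sq]
    simp only [Function.comp]
    rw [← Fin.sum_univ_eq_sum_range (fun u => (∑ s, t s * projFun (normCDF Q) g s (Z g u)) ^ 2),
      ← Fin.sum_univ_eq_sum_range (fun u => ∑ s, t s * projFun (normCDF Q) g s (Z g u))]

/-- Convergence of the conditional laws along a fixed realization of the data. -/
lemma tendsto_blDist_bootLaw (hN : Tendsto (fun m => ∑ i, n m i) atTop atTop)
    (hlam : ∀ i, 0 < lam i)
    (hn : ∀ i, Tendsto (fun m => (n m i : ℝ) / ((∑ l, n m l : ℕ) : ℝ)) atTop (𝓝 (lam i)))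
    (hGC : ∀ i j, ∀ ε > 0, ∀ᶠ k : ℕ in atTop, ∀ t, |(k : ℝ)⁻¹ * ∑ u ∈ Finset.range k,
      countFun (t - Z i u j) - normCDF Q i j t| ≤ ε)
    (hmean : ∀ g s, Tendsto (fun k : ℕ => (k : ℝ)⁻¹ *
      ∑ u ∈ Finset.range k, projFun (normCDF Q) g s (Z g u)) atTop
      (𝓝 (∫ y, projFun (normCDF Q) g s y ∂(Q g))))
    (hprod : ∀ g s s', Tendsto (fun k : ℕ => (k : ℝ)⁻¹ *
      ∑ u ∈ Finset.range k, projFun (normCDF Q) g s (Z g u) * projFun (normCDF Q) g s' (Z g u))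
      atTop (𝓝 (∫ y, projFun (normCDF Q) g s y * projFun (normCDF Q) g s' y ∂(Q g)))) :
    Tendsto (fun m => blDist (bootLaw fun i (k : Fin (n m i)) => Z i k)
      (multivariateGaussian 0 (limitCov Q lam))) atTop (𝓝 0) := by
  let x (m : ℕ) : (i : Fin a) → Fin (n m i) → Fin d → ℝ := fun i k => Z i k
  let L (m : ℕ) : ProbabilityMeasure (EuclideanSpace ℝ (Fin a × Fin d)) :=
    ⟨(indexLaw (n m)).map (linStat (x m) (normCDF Q)),
      Measure.isProbabilityMeasure_map Measurable.of_discrete.aemeasurable⟩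
  have hclt : Tendsto (fun m => blDist ((indexLaw (n m)).map (linStat (x m) (normCDF Q)))
      (multivariateGaussian 0 (limitCov Q lam))) atTop (𝓝 0) :=
    tendsto_blDist_of_tendsto (μ := L) (ν := ⟨multivariateGaussian 0 (limitCov Q lam), inferInstance⟩)
      (ProbabilityMeasure.tendsto_of_tendsto_charFun
        (tendsto_charFun_linStat hN hlam hn hmean hprod))
  have hlin : Tendsto (fun m => blDist (bootLaw (x m))
      ((indexLaw (n m)).map (linStat (x m) (normCDF Q)))) atTop (𝓝 0) := by
    rw [ENNReal.tendsto_nhds_zero]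
    intro δ hδ
    obtain ⟨η, hη0, hη⟩ : ∃ η : ℝ, 0 < η ∧ ENNReal.ofReal η ≤ δ := by
      rcases eq_or_ne δ ∞ with rfl | hδ'
      · exact ⟨1, one_pos, le_top⟩
      · exact ⟨δ.toReal, ENNReal.toReal_pos hδ.ne' hδ', by rw [ENNReal.ofReal_toReal hδ']⟩
    set C : ℝ := ∑ s : Fin a × Fin d, (1 / (a : ℝ)) * ∑ l,
        (2 * √(lam s.1)⁻¹ + 2 * √(lam l)⁻¹) with hC
    have hC0 : 0 ≤ C := by positivity
    -- With this accuracy the limit `ε C` of the linearization bound is strictly below `η`; adding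
    -- `1` allows `C = 0`.
    have hε : 0 < η / (C + 1) := by positivity
    have hεη : η / (C + 1) * C < η := by
      rw [div_mul_eq_mul_div, div_lt_iff₀ (by positivity)]
      nlinarith
    have hF : ∀ᶠ m in atTop, ∀ i j t, |empCDF (x m) i j t - normCDF Q i j t| ≤ η / (C + 1) := by
      refine eventually_all.2 fun i => eventually_all.2 fun j => ?_
      filter_upwards [(tendsto_size_atTop hN hlam hn i).eventually (hGC i j _ hε)] with m hm t
      have := hm t
      rwa [← Fin.sum_univ_eq_sum_range (fun u => countFun (t - Z i u j)), ← one_div] at this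
    filter_upwards [hF, (tendsto_sqrt_mul_linearization_bound (d := d) hN hlam hn
      (η / (C + 1))).eventually_lt_const hεη] with m hm hb
    refine le_trans ?_ hη
    unfold bootLaw
    refine (blDist_map_le _ Measurable.of_discrete Measurable.of_discrete
      (integrable_indexLaw _)).trans (ENNReal.ofReal_le_ofReal ?_)
    refine le_trans ?_ hb.le
    refine (integral_mono (integrable_indexLaw _) (integrable_indexLaw _) fun K =>
      dist_euclideanSpace_le_sum _ _).trans ?_
    rw [integral_finsetSum _ fun _ _ => integrable_indexLaw _]
    refine Finset.sum_le_sum fun s _ => ?_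
    simp only [linStat, ← mul_sub, abs_mul, integral_const_mul]
    rw [abs_of_nonneg (Real.sqrt_nonneg _)]
    exact mul_le_mul_of_nonneg_left (integral_abs_empEffect_sub_le (x m) _ hm s)
      (Real.sqrt_nonneg _)
  have h := hlin.add hclt
  rw [add_zero] at h
  exact tendsto_of_tendsto_of_tendsto_of_le_of_le tendsto_const_nhds h (fun _ => zero_le)
    fun m => blDist_triangle _ _ _

/-! ### From almost sure convergence to outer probability -/

variable {Ω : Type*} [MeasurableSpace Ω] {P : Measure Ω} [IsProbabilityMeasure P]
  {X : Fin a → ℕ → Ω → Fin d → ℝ}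

lemma measurable_countFun : Measurable countFun := by
  unfold countFun
  exact (Measurable.ite measurableSet_Ioi measurable_const measurable_const).add
    (Measurable.ite (measurableSet_singleton 0) measurable_const measurable_const)

omit [IsProbabilityMeasure P] in
lemma measurable_empEffect {k : Fin a → ℕ} {x : Ω → (i : Fin a) → Fin (k i) → Fin d → ℝ}
    (hx : ∀ i u j, Measurable fun ω => x ω i u j) (i : Fin a) (j : Fin d) :
    Measurable fun ω => empEffect (x ω) i j := by
  unfold empEffect meanEmpCDF empCDF
  refine (Finset.measurable_fun_sum _ fun u _ => (Finset.measurable_fun_sum _ fun l _ =>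
    (Finset.measurable_fun_sum _ fun v _ => ?_).const_mul _).const_mul _).const_mul _
  exact measurable_countFun.comp ((hx i u j).sub (hx l v j))

lemma measurable_blDist_bootLaw (hmeas : ∀ i k, Measurable (X i k)) {k : Fin a → ℕ}
    [∀ i, NeZero (k i)] (ν : Measure (EuclideanSpace ℝ (Fin a × Fin d))) :
    Measurable fun ω => blDist (bootLaw fun i (u : Fin (k i)) => X i u ω) ν := by
  unfold bootLaw
  refine (measurable_blDist_map (indexLaw k) ν).comp (measurable_pi_lambda _ fun K => ?_)
  refine (WithLp.measurable_toLp 2 _).comp (measurable_pi_lambda _ fun s => ?_)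
  have hX i u j : Measurable fun ω => X i u ω j := (measurable_pi_apply j).comp (hmeas i u)
  exact ((measurable_empEffect (fun i u j => hX _ _ _) _ _).sub
    (measurable_empEffect (fun i u j => hX _ _ _) _ _)).const_mul _

lemma ae_tendsto_blDist_bootLaw (hmeas : ∀ i k, Measurable (X i k))
    (hindep : iIndepFun (fun s : Fin a × ℕ => X s.1 s.2) P)
    (hlaw : ∀ i k, P.map (X i k) = Q i)
    (hN : Tendsto (fun m => ∑ i, n m i) atTop atTop) (hlam : ∀ i, 0 < lam i)
    (hn : ∀ i, Tendsto (fun m => (n m i : ℝ) / ((∑ l, n m l : ℕ) : ℝ)) atTop (𝓝 (lam i))) :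
    ∀ᵐ ω ∂P, Tendsto (fun m => blDist (bootLaw fun i (k : Fin (n m i)) => X i k ω)
      (multivariateGaussian 0 (limitCov Q lam))) atTop (𝓝 0) := by
  have hind i : iIndepFun (X i) P :=
    hindep.precomp (g := fun k : ℕ => (i, k)) fun k m h => (Prod.ext_iff.1 h).2
  have hGC : ∀ᵐ ω ∂P, ∀ i j, ∀ ε > 0, ∀ᶠ k : ℕ in atTop, ∀ t, |(k : ℝ)⁻¹ *
      ∑ u ∈ Finset.range k, countFun (t - X i u ω j) - normCDF Q i j t| ≤ ε := by
    refine ae_all_iff.2 fun i => ae_all_iff.2 fun j => ?_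
    have : IsProbabilityMeasure ((Q i).map fun y => y j) :=
      Measure.isProbabilityMeasure_map (measurable_pi_apply j).aemeasurable
    have hmap k : P.map (fun ω => X i k ω j) = (Q i).map fun y => y j := by
      rw [← hlaw i k, Measure.map_map (measurable_pi_apply j) (hmeas i k)]
      rfl
    have h := glivenko_cantelli (P := P) (Y := fun k ω => X i k ω j)
      (fun k => (measurable_pi_apply j).comp (hmeas i k))
      ((hind i).comp (fun _ y => y j) fun _ => measurable_pi_apply j) hmap
    simpa only [normCDF_eq_map] using h
  have hψ := measurable_projFun (measurable_normCDF Q)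
  have hψ2 := abs_projFun_le (abs_normCDF_le Q)
  have hmean : ∀ᵐ ω ∂P, ∀ g s, Tendsto (fun k : ℕ => (k : ℝ)⁻¹ *
      ∑ u ∈ Finset.range k, projFun (normCDF Q) g s (X g u ω)) atTop
      (𝓝 (∫ y, projFun (normCDF Q) g s y ∂(Q g))) :=
    ae_all_iff.2 fun g => ae_all_iff.2 fun s =>
      tendsto_mean_of_bounded (hmeas g) (hind g) (hlaw g)
        (f := projFun (normCDF Q) g s) (hψ g s) (hψ2 g s)
  have hprod : ∀ᵐ ω ∂P, ∀ g s s', Tendsto (fun k : ℕ => (k : ℝ)⁻¹ * ∑ u ∈ Finset.range k,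
      projFun (normCDF Q) g s (X g u ω) * projFun (normCDF Q) g s' (X g u ω))
      atTop (𝓝 (∫ y, projFun (normCDF Q) g s y * projFun (normCDF Q) g s' y ∂(Q g))) :=
    ae_all_iff.2 fun g => ae_all_iff.2 fun s => ae_all_iff.2 fun s' =>
      tendsto_mean_of_bounded (hmeas g) (hind g) (hlaw g)
        (f := fun y => projFun (normCDF Q) g s y * projFun (normCDF Q) g s' y)
        ((hψ g s).mul (hψ g s')) (C := 2 * 2)
        fun y => by
          rw [abs_mul]
          exact mul_le_mul (hψ2 g s y) (hψ2 g s' y) (abs_nonneg _) (by norm_num)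
  filter_upwards [hGC, hmean, hprod] with ω h1 h2 h3
  exact tendsto_blDist_bootLaw (Z := fun i k => X i k ω) hN hlam hn h1 h2 h3

/-- The events are measurable by `measurable_blDist_bootLaw`, and almost surely their indicators are
eventually `0`, so their probabilities tend to that of the empty set. -/
lemma condTendstoInOuterProb_bootLaw (hmeas : ∀ i k, Measurable (X i k))
    (hindep : iIndepFun (fun s : Fin a × ℕ => X s.1 s.2) P)
    (hlaw : ∀ i k, P.map (X i k) = Q i)
    (hN : Tendsto (fun m => ∑ i, n m i) atTop atTop) (hlam : ∀ i, 0 < lam i)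
    (hn : ∀ i, Tendsto (fun m => (n m i : ℝ) / ((∑ l, n m l : ℕ) : ℝ)) atTop (𝓝 (lam i))) :
    CondTendstoInOuterProb P (fun m ω => bootLaw fun i (k : Fin (n m i)) => X i k ω)
      (multivariateGaussian 0 (limitCov Q lam)) := by
  intro ε hε
  rw [← measure_empty (μ := P)]
  refine tendsto_measure_of_ae_tendsto_indicator_of_isFiniteMeasure atTop MeasurableSet.empty
    (fun m => measurableSet_le measurable_const (measurable_blDist_bootLaw hmeas _)) ?_
  filter_upwards [ae_tendsto_blDist_bootLaw hmeas hindep hlaw hN hlam hn] with ω hω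
  filter_upwards [hω.eventually_lt_const hε] with m hm
  simpa using hm

end Convergence

end MannWhitneyManova

theorem theorem3 {a d : ℕ} {Ω : Type*} [MeasurableSpace Ω]
    (P : Measure Ω) [IsProbabilityMeasure P]
    (X : Fin a → ℕ → Ω → Fin d → ℝ)
    (hmeas : ∀ i k, Measurable (X i k))
    (hindep : iIndepFun (fun s : Fin a × ℕ => X s.1 s.2) P)
    (Q : Fin a → Measure (Fin d → ℝ))
    (hlaw : ∀ i k, P.map (X i k) = Q i)
    (n : ℕ → Fin a → ℕ) (lam : Fin a → ℝ)
    (hN : Tendsto (fun m => ∑ i, n m i) atTop atTop)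
    (hlam : ∀ i, lam i ∈ Set.Ioo (0 : ℝ) 1)
    (hn : ∀ i, Tendsto (fun m => (n m i : ℝ) / ((∑ l, n m l : ℕ) : ℝ)) atTop (𝓝 (lam i))) :
    (MannWhitneyManova.limitCov Q lam).PosSemidef ∧
    MannWhitneyManova.CondTendstoInOuterProb P
      (fun m ω => MannWhitneyManova.bootLaw
        (fun (i : Fin a) (k : Fin (n m i)) => X i k ω))
      (multivariateGaussian 0 (MannWhitneyManova.limitCov Q lam)) := by
  have (i : Fin a) : IsProbabilityMeasure (Q i) :=
    hlaw i 0 ▸ Measure.isProbabilityMeasure_map (hmeas i 0).aemeasurable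
  have hlam0 i : 0 < lam i := (hlam i).1
  refine ⟨MannWhitneyManova.posSemidef_limitCov Q fun i => (hlam0 i).le, ?_⟩
  -- The lemmas assume nonempty groups for every `m`. Group sizes tend to infinity, so replacing
  -- them by `max (n m i) 1` changes only finitely many `m`.
  have hsize : ∀ᶠ m in atTop, (fun i => max (n m i) 1) = n m := by
    have := eventually_all.2 fun i =>
      (MannWhitneyManova.tendsto_size_atTop hN hlam0 hn i).eventually_ge_atTop 1
    filter_upwards [this] with m hm
    exact funext fun i => max_eq_left (hm i)
  have hne m i : NeZero (max (n m i) 1) := ⟨by positivity⟩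
  have key := MannWhitneyManova.condTendstoInOuterProb_bootLaw (n := fun m i => max (n m i) 1)
    hmeas hindep hlaw
    (hN.congr' (by filter_upwards [hsize] with m hm; rw [← hm]; simp)) hlam0
    fun i => (hn i).congr' (by filter_upwards [hsize] with m hm; rw [← hm]; simp)
  intro ε hε
  refine (key ε hε).congr' ?_
  filter_upwards [hsize] with m hm
  exact congrArg (fun k : Fin a → ℕ => P {ω | ε ≤ MannWhitneyManova.blDist
    (MannWhitneyManova.bootLaw (fun (i : Fin a) (u : Fin (k i)) => X i u ω))
    (multivariateGaussian 0 (MannWhitneyManova.limitCov Q lam))}) hm
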